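/- Let $c>1$ be an integer coprime to $6$, let $N>1$ be an integer coprime to $c$, and let $(n_D)_{D\mid N}$ be integers, indexed by the positive divisors of $N$, with $\sum_{D\mid N} n_D\cdot D=0$. Put $\delta=\sum_{D\mid N}n_D\,[LR(D)]\in\mathbb{Z}[\mathrm{GL}_2^+(\mathbb{Q})]$, where $LR(D)=\begin{pmatrix}1&0\\0&D\end{pmatrix}$. For a finite set of primes $S$ let $\mathcal{S}(V_{\mathbb{A}^S})=\bigotimes'_{\ell\notin S}\mathcal{S}(\mathbb{Q}_\ell^2)$ be the restricted tensor product, with respect to the characteristic functions $f_\ell^0$ of $\mathbb{Z}_\ell^2$, of the groups of locally constant, compactly supported functions $\mathbb{Q}_\ell^2\to\mathbb{Z}$. Regard it as a group of functions on the row vectors $V_{\mathbb{A}^S}=(\mathbb{A}^S)^2$ over the finite adeles away from $S$, with $(f\mid\gamma)(v)=f(v\gamma^{-1})$ for $\gamma\in \mathrm{GL}_2(\mathbb{Q})$, and let $\mathcal{S}(V_{\mathbb{A}^S}')$ be the subgroup of those $f$ with $f(0)=0$. Tensoring with $\bigotimes_{\ell\in S}f_\ell^0$ and restricting to $\mathbb{Q}^2$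 identifies $f\in \mathcal{S}(V_{\mathbb{A}^S}')$ with a function on $V=\mathbb{Q}^2$; let $\mathcal{S}(V_S')$ be the group of the functions on $\mathbb{Q}^2$ so obtained. Let $\mathscr{S}$ be the set of primes dividing $c$ and $\mathscr{N}$ the set of primes dividing $cN$. For $f\in\mathcal{S}(V_{\mathbb{A}^{\mathscr N}}')$ put $f^D:=(f\mid LR(D))\otimes\bigotimes_{\ell\in\mathscr{N}-\mathscr{S}}f_\ell^0\in \mathcal{S}(V_{\mathbb{A}^{\mathscr S}}')$. Let $\mathcal{O}_{\mathcal H}^\times$ be the group of nowhere vanishing holomorphic functions on the upper half plane $\mathcal{H}$. With $q=e^{2\pi i\tau}$, $t=e^{2\pi i u}$ let $$\Theta(u,\tau)=q^{1/12}(t^{1/2}-t^{-1/2})\prod_{m>0}(1-q^mt)(1-q^mt^{-1}),\qquad \vartheta_c(u,\tau)=(-1)^{(c-1)/2}\,\Theta(u,\tau)^{c^2}\,\Theta(cu,\tau)^{-1}.$$ The Kato–Siegel distribution is the homomorphism $\mu_{KS}:\mathcal{S}(V_{\mathbb{A}^{\mathscr S}}')\to\mathcal{O}_{\mathcal H}^\times$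 given as follows: if $f$, viewed as a function on $\mathbb{Q}^2$, is $k\mathbb{Z}^2$-periodic with $k\ge1$ coprime to $c$, then $$\mu_{KS}(f)(\tau)=\prod_{(a,b)\in\mathbb{Q}^2/\mathbb{Z}^2}\vartheta_c(a\tau+b,\tau)^{f(ka,kb)},$$ which does not depend on $k$. (It is the unique distribution, invariant under scalars in $\mathbb{Z}_{\mathscr S}^\times$, where $\mathbb{Z}_{\mathscr S}$ is the ring of rational numbers integral at the primes in $\mathscr S$, that takes the characteristic function of $(a,b)+\mathbb{Z}^2$ to $\vartheta_c(a\tau+b,\tau)$ for all $(a,b)\in\mathbb{Z}_{\mathscr S}^2\setminus\mathbb{Z}^2$.) Its $\delta$-smoothing is the distribution $$\mu_{KS}^\delta(f)(\tau)=\prod_{D\mid N}\mu_{KS}(f^D)(D\tau)^{n_D},\qquad f\in\mathcal{S}(V_{\mathbb{A}^{\mathscr N}}')\cong\mathcal{S}(V_{\mathscr N}').$$ Then for every $f\in\mathcal{S}(V_{\mathscr N}')$ the unit $\mu_{KS}^\delta(f)$ satisfies $\mathrm{Ord}_q(\mu_{KS}^\delta(f))=0$: for some integer $h>0$ the function $\mu_{KS}^\delta(f)$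 is invariant under $\tau\mapsto\tau+h$ and, as a function of $q_h=e^{2\pi i\tau/h}$, it is meromorphic at $q_h=0$ with order $0$ there. -/

import Mathlib

open scoped RestrictedProduct MatrixGroups
open Filter Matrix

noncomputable section

namespace KatoSiegel

/-! ### Adelic test functions -/

/-- The primes outside a set `S`. -/
abbrev Off (S : Set ℕ) : Type := {ℓ : ℕ // ℓ.Prime ∧ ℓ ∉ S}

instance (S : Set ℕ) (ℓ : Off S) : Fact (ℓ : ℕ).Prime := ⟨ℓ.2.1⟩

/-- The ring `𝔸^S` of finite adeles away from `S`. -/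
abbrev Adele (S : Set ℕ) : Type := Πʳ ℓ : Off S, [ℚ_[(ℓ : ℕ)], PadicInt.subring (ℓ : ℕ)]

theorem eventually_norm_le_one (S : Set ℕ) (x : ℚ) :
    ∀ᶠ ℓ : Off S in cofinite, ‖(x : ℚ_[(ℓ : ℕ)])‖ ≤ 1 := by
  have hfin : {ℓ : Off S | (ℓ : ℕ) ∣ x.den}.Finite :=
    Set.Finite.of_injOn (f := fun ℓ : Off S => (ℓ : ℕ)) (t := {d | d ∣ x.den})
      (fun ℓ h => h) Subtype.val_injective.injOn
      ((Set.finite_Iic x.den).subset fun d hd => Nat.le_of_dvd x.den_pos hd)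
  filter_upwards [hfin.compl_mem_cofinite] with ℓ hℓ
  exact Padic.norm_rat_le_one hℓ

/-- The diagonal embedding `ℚ → 𝔸^S`. -/
def diag (S : Set ℕ) : ℚ →+* Adele S where
  toFun x := ⟨fun ℓ => (x : ℚ_[(ℓ : ℕ)]), eventually_norm_le_one S x⟩
  map_one' := by ext ℓ; exact Rat.cast_one
  map_zero' := by ext ℓ; exact Rat.cast_zero
  map_mul' x y := by ext ℓ; exact Rat.cast_mul x y
  map_add' x y := by ext ℓ; exact Rat.cast_add x y

@[simp] theorem diag_apply (S : Set ℕ) (x : ℚ) (ℓ : Off S) : diag S x ℓ = (x : ℚ_[(ℓ : ℕ)]) := rfl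

/-- The projection `𝔸^S → 𝔸^T` forgetting the primes in `T - S`. -/
def forget {S T : Set ℕ} (h : S ⊆ T) : Adele S →+* Adele T :=
  RestrictedProduct.mapAlongRingHom _ _ (fun ℓ : Off T => (⟨ℓ, ℓ.2.1, fun hS => ℓ.2.2 (h hS)⟩ : Off S))
    (Function.Injective.tendsto_cofinite fun _ _ hab => Subtype.ext (Subtype.mk.inj hab))
    (fun _ => RingHom.id _) (Eventually.of_forall fun _ _ hx => hx)

/-- A test function on `V_ℓ = ℚ_ℓ²`: locally constant with compact support. -/
def IsLocalTest (ℓ : ℕ) [Fact ℓ.Prime] (f : (Fin 2 → ℚ_[ℓ]) → ℤ) : Prop :=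
  IsLocallyConstant f ∧ HasCompactSupport f

open Classical in
/-- The characteristic function `f_ℓ^0` of `ℤ_ℓ² ⊆ V_ℓ`. -/
def unitBox (ℓ : ℕ) [Fact ℓ.Prime] (v : Fin 2 → ℚ_[ℓ]) : ℤ :=
  if ∀ i, ‖v i‖ ≤ 1 then 1 else 0

/-- The function on `V_{𝔸^S}` given by the simple tensor `⊗ f_ℓ`. -/
def tensor {S : Set ℕ} (f : ∀ ℓ : Off S, (Fin 2 → ℚ_[(ℓ : ℕ)]) → ℤ) (v : Fin 2 → Adele S) : ℤ :=
  ∏ᶠ ℓ : Off S, f ℓ (fun i => v i ℓ)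

/-- The families `(f_ℓ)` of local test functions with `f_ℓ = f_ℓ^0` for almost all `ℓ`. -/
def IsTensorFamily {S : Set ℕ} (f : ∀ ℓ : Off S, (Fin 2 → ℚ_[(ℓ : ℕ)]) → ℤ) : Prop :=
  (∀ ℓ : Off S, IsLocalTest (ℓ : ℕ) (f ℓ)) ∧ ∀ᶠ ℓ : Off S in cofinite, f ℓ = unitBox (ℓ : ℕ)

/-- The group `𝒮(V_{𝔸^S})` of `S`-adelic test functions: the restricted tensor product of the
groups `𝒮(V_ℓ)`, `ℓ ∉ S`, realised as the group of functions on `V_{𝔸^S}` (row vectors)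
generated by the simple tensors. -/
def testFn (S : Set ℕ) : AddSubgroup ((Fin 2 → Adele S) → ℤ) :=
  AddSubgroup.closure {F | ∃ f, IsTensorFamily f ∧ F = tensor f}

/-- The subgroup of the test functions that vanish at `0`. -/
def testFn₀ (S : Set ℕ) : AddSubgroup ((Fin 2 → Adele S) → ℤ) where
  carrier := {F | F ∈ testFn S ∧ F 0 = 0}
  zero_mem' := ⟨zero_mem _, rfl⟩
  add_mem' := fun ha hb => ⟨add_mem ha.1 hb.1, by simp [ha.2, hb.2]⟩
  neg_mem' := fun ha => ⟨neg_mem ha.1, by simp [ha.2]⟩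

/-- `v γ⁻¹` for a row vector `v` over `𝔸^S` and `γ ∈ GL₂(ℚ)`. -/
def vecAct {S : Set ℕ} (γ : GL (Fin 2) ℚ) (v : Fin 2 → Adele S) : Fin 2 → Adele S :=
  v ᵥ* ((γ⁻¹ : GL (Fin 2) ℚ) : Matrix (Fin 2) (Fin 2) ℚ).map (diag S)

theorem isLocalTest_unitBox (ℓ : ℕ) [Fact ℓ.Prime] : IsLocalTest ℓ (unitBox ℓ) := by
  have hset : {v : Fin 2 → ℚ_[ℓ] | ∀ i, ‖v i‖ ≤ 1} =
      Set.univ.pi fun _ : Fin 2 => Metric.closedBall (0 : ℚ_[ℓ]) 1 := by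
    ext v; simp
  have hclopen : IsClopen {v : Fin 2 → ℚ_[ℓ] | ∀ i, ‖v i‖ ≤ 1} := by
    rw [hset]
    exact ⟨isClosed_set_pi fun _ _ => Metric.isClosed_closedBall,
      isOpen_set_pi Set.finite_univ fun _ _ =>
        IsUltrametricDist.isOpen_closedBall _ one_ne_zero⟩
  constructor
  · have := (LocallyConstant.charFn ℤ hclopen).isLocallyConstant
    convert this using 1
    ext v
    simp [unitBox, LocallyConstant.coe_charFn, Set.indicator]
  · refine HasCompactSupport.intro (K := {v : Fin 2 → ℚ_[ℓ] | ∀ i, ‖v i‖ ≤ 1}) ?_ ?_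
    · rw [hset]
      exact isCompact_univ_pi fun _ => isCompact_closedBall _ _
    · intro v hv
      exact if_neg hv

theorem IsLocalTest.comp_vecMul {ℓ : ℕ} [Fact ℓ.Prime] {f : (Fin 2 → ℚ_[ℓ]) → ℤ}
    (hf : IsLocalTest ℓ f) (M M' : Matrix (Fin 2) (Fin 2) ℚ_[ℓ]) (h : M * M' = 1) (h' : M' * M = 1) :
    IsLocalTest ℓ (fun v => f (v ᵥ* M)) := by
  let e : (Fin 2 → ℚ_[ℓ]) ≃ₜ (Fin 2 → ℚ_[ℓ]) :=
    { toFun := fun v => v ᵥ* M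
      invFun := fun v => v ᵥ* M'
      left_inv := fun v => by simp [h]
      right_inv := fun v => by simp [h']
      continuous_toFun := by fun_prop
      continuous_invFun := by fun_prop }
  exact ⟨hf.1.comp_continuous e.continuous, hf.2.comp_homeomorph e⟩

theorem norm_vecMul_le_one {ℓ : ℕ} [Fact ℓ.Prime] {M : Matrix (Fin 2) (Fin 2) ℚ_[ℓ]}
    (hM : ∀ i j, ‖M i j‖ ≤ 1) {v : Fin 2 → ℚ_[ℓ]} (hv : ∀ i, ‖v i‖ ≤ 1) (j : Fin 2) :
    ‖(v ᵥ* M) j‖ ≤ 1 := by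
  have key : ∀ i, ‖v i * M i j‖ ≤ 1 := fun i => by
    rw [norm_mul]; exact mul_le_one₀ (hv i) (norm_nonneg _) (hM i j)
  simp only [vecMul, dotProduct, Fin.sum_univ_two]
  exact (Padic.nonarchimedean _ _).trans (max_le (key 0) (key 1))

/-- The matrix `γ` over `ℚ_ℓ`. -/
def locMat (ℓ : ℕ) [Fact ℓ.Prime] (M : Matrix (Fin 2) (Fin 2) ℚ) : Matrix (Fin 2) (Fin 2) ℚ_[ℓ] :=
  M.map (Rat.castHom ℚ_[ℓ])

theorem locMat_mul (ℓ : ℕ) [Fact ℓ.Prime] (M M' : Matrix (Fin 2) (Fin 2) ℚ) (h : M * M' = 1) :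
    locMat ℓ M * locMat ℓ M' = 1 := by
  rw [locMat, locMat, ← Matrix.map_mul, h]
  simp

theorem vecAct_apply {S : Set ℕ} (γ : GL (Fin 2) ℚ) (v : Fin 2 → Adele S) (ℓ : Off S) :
    (fun j => vecAct γ v j ℓ) =
      (fun i => v i ℓ) ᵥ* locMat ℓ ((γ⁻¹ : GL (Fin 2) ℚ) : Matrix (Fin 2) (Fin 2) ℚ) := by
  funext j
  simp [vecAct, vecMul, dotProduct, Fin.sum_univ_two, locMat]

theorem comp_vecAct_mem {S : Set ℕ} (γ : GL (Fin 2) ℚ) {F : (Fin 2 → Adele S) → ℤ}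
    (hF : F ∈ testFn S) : (fun v => F (vecAct γ v)) ∈ testFn S := by
  induction hF using AddSubgroup.closure_induction with
  | mem F hF =>
    obtain ⟨f, hf, rfl⟩ := hF
    have h1 : ((γ⁻¹ : GL (Fin 2) ℚ) : Matrix (Fin 2) (Fin 2) ℚ) * (γ : Matrix (Fin 2) (Fin 2) ℚ) = 1 :=
      Units.inv_mul γ
    have h2 : (γ : Matrix (Fin 2) (Fin 2) ℚ) * ((γ⁻¹ : GL (Fin 2) ℚ) : Matrix (Fin 2) (Fin 2) ℚ) = 1 :=
      Units.mul_inv γ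
    refine AddSubgroup.subset_closure
      ⟨fun ℓ v => f ℓ (v ᵥ* locMat ℓ ((γ⁻¹ : GL (Fin 2) ℚ) : Matrix (Fin 2) (Fin 2) ℚ)), ⟨?_, ?_⟩, ?_⟩
    · intro ℓ
      exact (hf.1 ℓ).comp_vecMul _ _ (locMat_mul ℓ _ _ h1) (locMat_mul ℓ _ _ h2)
    · have e1 : ∀ M : Matrix (Fin 2) (Fin 2) ℚ,
          ∀ᶠ ℓ : Off S in cofinite, ∀ i j, ‖locMat (ℓ : ℕ) M i j‖ ≤ 1 := by
        intro M
        simp only [eventually_all]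
        intro i j
        exact eventually_norm_le_one S (M i j)
      filter_upwards [hf.2, e1 ((γ⁻¹ : GL (Fin 2) ℚ) : Matrix (Fin 2) (Fin 2) ℚ),
        e1 (γ : Matrix (Fin 2) (Fin 2) ℚ)] with ℓ hℓ ha hb
      funext v
      rw [hℓ]
      have : (∀ i, ‖(v ᵥ* locMat (ℓ : ℕ) ((γ⁻¹ : GL (Fin 2) ℚ) : Matrix (Fin 2) (Fin 2) ℚ)) i‖ ≤ 1) ↔
          ∀ i, ‖v i‖ ≤ 1 := by
        constructor
        · intro h
          have := norm_vecMul_le_one hb h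
          rw [vecMul_vecMul, locMat_mul _ _ _ h1, vecMul_one] at this
          exact this
        · exact norm_vecMul_le_one ha
      simp only [unitBox, this]
    · funext v
      simp only [tensor, vecAct_apply]
  | zero => exact zero_mem _
  | add F G _ _ hF hG => exact add_mem hF hG
  | neg F _ hF => exact neg_mem hF

/-- The right action `(f ∣ γ)(v) = f(v γ⁻¹)` of `GL₂(ℚ)` on test functions. -/
def testAct {S : Set ℕ} (γ : GL (Fin 2) ℚ) : testFn₀ S →+ testFn₀ S where
  toFun F := ⟨fun v => F.1 (vecAct γ v), comp_vecAct_mem γ F.2.1, by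
    have : vecAct γ (0 : Fin 2 → Adele S) = 0 := Matrix.zero_vecMul _
    simpa [this] using F.2.2⟩
  map_zero' := rfl
  map_add' _ _ := rfl

open Classical in
/-- `f ⊗ f^0_{T - S}` as a function on `V_{𝔸^S}`. -/
def extendFun {S T : Set ℕ} (h : S ⊆ T) (F : (Fin 2 → Adele T) → ℤ) (v : Fin 2 → Adele S) : ℤ :=
  if ∀ ℓ : Off S, (ℓ : ℕ) ∈ T → ∀ i, ‖v i ℓ‖ ≤ 1 then F (fun i => forget h (v i)) else 0

open Classical in
/-- The family `(f_ℓ)_{ℓ ∉ T}` completed by `f_ℓ^0` at the primes of `T - S`. -/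
def extendFam {S T : Set ℕ} (f : ∀ ℓ : Off T, (Fin 2 → ℚ_[(ℓ : ℕ)]) → ℤ) (ℓ : Off S) :
    (Fin 2 → ℚ_[(ℓ : ℕ)]) → ℤ :=
  if hℓ : (ℓ : ℕ) ∈ T then unitBox (ℓ : ℕ) else f ⟨ℓ, ℓ.2.1, hℓ⟩

theorem IsTensorFamily.finite_mulSupport {S : Set ℕ}
    {f : ∀ ℓ : Off S, (Fin 2 → ℚ_[(ℓ : ℕ)]) → ℤ} (hf : IsTensorFamily f) (v : Fin 2 → Adele S) :
    (Function.mulSupport fun ℓ : Off S => f ℓ (fun i => v i ℓ)).Finite := by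
  have hv : ∀ᶠ ℓ : Off S in cofinite, ∀ i, ‖v i ℓ‖ ≤ 1 := by
    rw [eventually_all]
    exact fun i => (v i).2
  have := hf.2.and hv
  refine Set.Finite.subset (Filter.eventually_cofinite.1 this) fun ℓ hℓ => ?_
  rintro ⟨h1, h2⟩
  exact hℓ (by simp only [h1]; exact if_pos h2)

theorem extendFam_isTensorFamily {S T : Set ℕ} (h : S ⊆ T)
    {f : ∀ ℓ : Off T, (Fin 2 → ℚ_[(ℓ : ℕ)]) → ℤ} (hf : IsTensorFamily f) :
    IsTensorFamily (extendFam f : ∀ ℓ : Off S, (Fin 2 → ℚ_[(ℓ : ℕ)]) → ℤ) := by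
  constructor
  · intro ℓ
    by_cases hℓ : (ℓ : ℕ) ∈ T
    · simpa only [extendFam, dif_pos hℓ] using isLocalTest_unitBox (ℓ : ℕ)
    · simpa only [extendFam, dif_neg hℓ] using hf.1 ⟨ℓ, ℓ.2.1, hℓ⟩
  · have hfin := Filter.eventually_cofinite.1 hf.2
    refine Filter.eventually_cofinite.2 ((hfin.image
      (fun ℓ : Off T => (⟨ℓ, ℓ.2.1, fun hS => ℓ.2.2 (h hS)⟩ : Off S))).subset ?_)
    intro ℓ hℓ
    by_cases hT : (ℓ : ℕ) ∈ T
    · exact absurd (by simp only [extendFam, dif_pos hT]) hℓ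
    · refine ⟨⟨ℓ, ℓ.2.1, hT⟩, fun hh => hℓ ?_, rfl⟩
      simpa only [extendFam, dif_neg hT] using hh

theorem extendFun_tensor {S T : Set ℕ} (h : S ⊆ T)
    {f : ∀ ℓ : Off T, (Fin 2 → ℚ_[(ℓ : ℕ)]) → ℤ} (hf : IsTensorFamily f) :
    extendFun h (tensor f) = tensor (extendFam f : ∀ ℓ : Off S, (Fin 2 → ℚ_[(ℓ : ℕ)]) → ℤ) := by
  funext v
  have hfin := (extendFam_isTensorFamily h hf).finite_mulSupport v
  by_cases hv : ∀ ℓ : Off S, (ℓ : ℕ) ∈ T → ∀ i, ‖v i ℓ‖ ≤ 1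
  · rw [extendFun, if_pos hv]
    let ι : Off T → Off S := fun ℓ => ⟨ℓ, ℓ.2.1, fun hS => ℓ.2.2 (h hS)⟩
    have hι : Function.Injective ι := fun _ _ hab => Subtype.ext (Subtype.mk.inj hab)
    have hsub : (Function.mulSupport fun ℓ : Off S => extendFam f ℓ (fun i => v i ℓ)) ⊆
        Set.range ι := by
      intro ℓ hℓ
      by_cases hT : (ℓ : ℕ) ∈ T
      · refine absurd ?_ hℓ
        simp only [extendFam, dif_pos hT]
        exact if_pos (hv ℓ hT)
      · exact ⟨⟨ℓ, ℓ.2.1, hT⟩, rfl⟩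
    rw [tensor, tensor, ← finprod_mem_univ (fun ℓ : Off S => extendFam f ℓ (fun i => v i ℓ)),
      ← finprod_mem_inter_mulSupport, Set.univ_inter, ← Set.inter_eq_right.2 hsub,
      finprod_mem_inter_mulSupport, finprod_mem_range hι]
    refine finprod_congr fun ℓ => ?_
    have hT : ((ι ℓ : Off S) : ℕ) ∉ T := ℓ.2.2
    simp only [extendFam, dif_neg hT]
    rfl
  · rw [extendFun, if_neg hv]
    push Not at hv
    obtain ⟨ℓ, hT, i, hi⟩ := hv
    rw [tensor, finprod_eq_prod _ hfin]
    symm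
    have h0 : extendFam f ℓ (fun i => v i ℓ) = 0 := by
      simp only [extendFam, dif_pos hT]
      exact if_neg fun hh => absurd (hh i) (not_le.2 hi)
    refine Finset.prod_eq_zero (i := ℓ) ?_ h0
    rw [Set.Finite.mem_toFinset, Function.mem_mulSupport, h0]
    exact zero_ne_one

theorem extendFun_mem {S T : Set ℕ} (h : S ⊆ T) {F : (Fin 2 → Adele T) → ℤ} (hF : F ∈ testFn T) :
    extendFun h F ∈ testFn S := by
  induction hF using AddSubgroup.closure_induction with
  | mem F hF =>
    obtain ⟨f, hf, rfl⟩ := hF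
    exact AddSubgroup.subset_closure ⟨_, extendFam_isTensorFamily h hf, extendFun_tensor h hf⟩
  | zero =>
    convert zero_mem (testFn S) using 1
    funext v
    simp [extendFun]
  | add F G _ _ hF hG =>
    convert add_mem hF hG using 1
    funext v
    simp only [extendFun, Pi.add_apply]
    split_ifs <;> simp
  | neg F _ hF =>
    convert neg_mem hF using 1
    funext v
    simp only [extendFun, Pi.neg_apply]
    split_ifs <;> simp

/-- The injection `i_T^S : f ↦ f ⊗ f^0_{T - S}` from `T`-adelic to `S`-adelic test functions,
for `S ⊆ T`. -/
def extend {S T : Set ℕ} (h : S ⊆ T) : testFn₀ T →+ testFn₀ S where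
  toFun F := ⟨extendFun h F.1, extendFun_mem h F.2.1, by
    have h0 : (fun i => forget h ((0 : Fin 2 → Adele S) i)) = 0 := by
      funext i; exact map_zero _
    rw [extendFun, h0, F.2.2, ite_self]⟩
  map_zero' := by
    ext v
    simp [extendFun]
  map_add' F G := by
    ext v
    simp only [extendFun, AddSubgroup.coe_add, Pi.add_apply]
    split_ifs <;> simp

/-- The test function `φ(f ⊗ f_S^0)` on `V = ℚ²` attached to an `S`-adelic test function `f`. -/
def toRat {S : Set ℕ} (F : testFn₀ S) (v : Fin 2 → ℚ) : ℤ :=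
  (extend (Set.empty_subset S) F).1 fun i => diag ∅ (v i)

/-! ### Distributions -/

/-- The group `𝒟'(V_{𝔸^S}, A)` of distributions, for an additively written abelian group `A`. -/
abbrev Distribution (S : Set ℕ) (A : Type*) [AddCommGroup A] : Type _ := testFn₀ S →+ A

/-- The pull-back `(i_T^S)^*` of distributions, for `S ⊆ T`. -/
def pullback {S T : Set ℕ} (h : S ⊆ T) {A : Type*} [AddCommGroup A] (μ : Distribution S A) :
    Distribution T A := μ.comp (extend h)

/-! ### The `GL₂⁺(ℚ)`-module `𝒪_ℋ^×` and smoothing -/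

open UpperHalfPlane

/-- The ring `𝒪_ℋ` of holomorphic functions on the upper half plane. -/
def Hol : Subring (ℍ → ℂ) where
  carrier := {g | DifferentiableOn ℂ (g ∘ ofComplex) upperHalfPlaneSet}
  mul_mem' := fun ha hb => ha.mul hb
  one_mem' := differentiableOn_const 1
  add_mem' := fun ha hb => ha.add hb
  zero_mem' := differentiableOn_const 0
  neg_mem' := fun ha => ha.neg

/-- An element of `𝒪_ℋ^×` (written additively) as a function on `ℋ`. -/
def unitFun (u : Additive Holˣ) : ℍ → ℂ := ((u.toMul : Hol) : ℍ → ℂ)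

/-- The action of `GL₂⁺(ℚ)` on `ℋ` by Möbius transformations. -/
def moebius (γ : GL(2, ℚ)⁺) (τ : ℍ) : ℍ :=
  (Matrix.GeneralLinearGroup.map (algebraMap ℚ ℝ) (γ : GL (Fin 2) ℚ)) • τ

theorem comp_moebius_mem (γ : GL(2, ℚ)⁺) {g : ℍ → ℂ} (hg : g ∈ Hol) :
    (fun τ => g (moebius γ τ)) ∈ Hol := by
  have hdet : 0 < (Matrix.GeneralLinearGroup.map (algebraMap ℚ ℝ) (γ : GL (Fin 2) ℚ)).det.val := by
    have h := γ.2
    rw [Matrix.mem_glpos] at h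
    rw [Matrix.GeneralLinearGroup.map_det]
    simpa using h
  have h1 := (mdifferentiable_iff.2 hg).comp (mdifferentiable_smul hdet)
  exact mdifferentiable_iff.1 h1

/-- The right action `(g ∣ γ)(τ) = g(γ τ)` on `𝒪_ℋ`. -/
def holAct (γ : GL(2, ℚ)⁺) : Hol →+* Hol where
  toFun g := ⟨fun τ => g.1 (moebius γ τ), comp_moebius_mem γ g.2⟩
  map_one' := rfl
  map_mul' _ _ := rfl
  map_zero' := rfl
  map_add' _ _ := rfl

/-- The right action of `GL₂⁺(ℚ)` on `𝒪_ℋ^×`, written additively. -/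
def unitAct (γ : GL(2, ℚ)⁺) : Additive Holˣ →+ Additive Holˣ :=
  MonoidHom.toAdditive (Units.map (holAct γ : Hol →* Hol))

/-- The left action `(γ ∗ μ)(f) = μ(f ∣ γ) ∣ γ⁻¹` of `GL₂⁺(ℚ)` on `𝒟'(V_{𝔸^S}, 𝒪_ℋ^×)`. -/
def distAct {S : Set ℕ} (γ : GL(2, ℚ)⁺) (μ : Distribution S (Additive Holˣ)) :
    Distribution S (Additive Holˣ) :=
  (unitAct γ⁻¹).comp (μ.comp (testAct (γ : GL (Fin 2) ℚ)))

/-- The `δ`-smoothing `μ^δ = δ ∗ μ = ∑ n_g • (g ∗ μ)` for `δ = ∑ n_g [g] ∈ ℤ[GL₂⁺(ℚ)]`. -/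
def smooth {S : Set ℕ} (δ : MonoidAlgebra ℤ GL(2, ℚ)⁺) (μ : Distribution S (Additive Holˣ)) :
    Distribution S (Additive Holˣ) :=
  δ.coeff.sum fun g n => n • distAct g μ

/-- The diagonal matrix `LR(x) = diag(1, x)`. -/
def LR (x : ℚ) (hx : 0 < x) : GL(2, ℚ)⁺ :=
  ⟨Matrix.GeneralLinearGroup.mkOfDetNeZero !![1, 0; 0, x] (by simpa using hx.ne'), by
    rw [Matrix.mem_glpos]; simpa [Matrix.GeneralLinearGroup.mkOfDetNeZero] using hx⟩

/-- The element `δ = ∑_{D ∣ N, D > 0} n_D [LR(D)]`. -/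
def delta (N : ℕ) (n : ℕ → ℤ) : MonoidAlgebra ℤ GL(2, ℚ)⁺ :=
  ∑ D ∈ N.divisors.attach,
    MonoidAlgebra.single (LR (D : ℕ) (by exact_mod_cast Nat.pos_of_mem_divisors D.2)) (n D)

/-! ### Siegel theta function and Kato–Siegel units -/

/-- `e(x) = exp(2πi x)`. -/
def ee (x : ℂ) : ℂ := Complex.exp (2 * Real.pi * Complex.I * x)

/-- `Θ(u, τ) = q^{1/12} (t^{1/2} - t^{-1/2}) ∏_{n > 0} (1 - qⁿ t)(1 - qⁿ t⁻¹)` with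
`q = exp(2πiτ)`, `t = exp(2πiu)`. -/
def Theta (u τ : ℂ) : ℂ :=
  ee (τ / 12) * (ee (u / 2) - ee (-u / 2)) *
    ∏' n : ℕ, (1 - ee τ ^ (n + 1) * ee u) * (1 - ee τ ^ (n + 1) * (ee u)⁻¹)

/-- The function `τ ↦ ϑ_c(aτ + b, τ)` for `v = (a, b)`, where
`ϑ_c(u, τ) = (-1)^{(c-1)/2} Θ(u, τ)^{c²} Θ(cu, τ)⁻¹`. -/
def ksFun (c : ℕ) (v : Fin 2 → ℚ) (τ : ℍ) : ℂ :=
  (-1) ^ ((c - 1) / 2) * Theta (v 0 * τ + v 1) τ ^ c ^ 2 * (Theta (c * (v 0 * τ + v 1)) τ)⁻¹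

theorem ee_ne_zero (x : ℂ) : ee x ≠ 0 := Complex.exp_ne_zero _

theorem ee_add (x y : ℂ) : ee (x + y) = ee x * ee y := by
  rw [ee, ee, ee, ← Complex.exp_add]; congr 1; ring

theorem ee_neg (x : ℂ) : ee (-x) = (ee x)⁻¹ := by
  rw [ee, ee, ← Complex.exp_neg]; congr 1; ring

theorem ee_zero : ee 0 = 1 := by simp [ee]

theorem ee_nat_mul (n : ℕ) (x : ℂ) : ee (n * x) = ee x ^ n := by
  rw [ee, ee, ← Complex.exp_nat_mul]; congr 1; ring

theorem ee_int_mul (n : ℤ) (x : ℂ) : ee (n * x) = ee x ^ n := by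
  rw [ee, ee, ← Complex.exp_int_mul]; congr 1; ring

theorem ee_eq_one_iff (x : ℂ) : ee x = 1 ↔ ∃ n : ℤ, x = n := by
  rw [ee, Complex.exp_eq_one_iff]
  refine exists_congr fun n => ?_
  have h := Complex.two_pi_I_ne_zero
  constructor
  · intro hh; exact mul_left_cancel₀ h (by rw [hh]; ring)
  · rintro rfl; ring

theorem ee_int (n : ℤ) : ee n = 1 := (ee_eq_one_iff _).2 ⟨n, rfl⟩

theorem ee_half : ee (1 / 2) = -1 := by
  rw [ee, show 2 * (Real.pi : ℂ) * Complex.I * (1 / 2) = Real.pi * Complex.I by ring,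
    Complex.exp_pi_mul_I]

theorem norm_ee (x : ℂ) : ‖ee x‖ = Real.exp (-2 * Real.pi * x.im) := by
  rw [ee, Complex.norm_exp]; simp

theorem norm_ee_lt_one {τ : ℂ} (hτ : 0 < τ.im) : ‖ee τ‖ < 1 := by
  rw [norm_ee, Real.exp_lt_one_iff]; nlinarith [Real.pi_pos]

theorem continuous_ee : Continuous ee := by unfold ee; fun_prop

theorem differentiable_ee : Differentiable ℂ ee := by unfold ee; fun_prop

theorem multipliable_one_sub {q : ℂ} (hq : ‖q‖ < 1) (x : ℂ) :
    Multipliable fun n : ℕ => 1 - q ^ (n + 1) * x := by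
  simp_rw [sub_eq_add_neg]
  refine multipliable_one_add_of_summable ?_
  simp only [norm_neg, norm_mul, norm_pow]
  exact ((summable_nat_add_iff 1).2 (summable_geometric_of_lt_one (norm_nonneg _) hq)).mul_right _

theorem tprod_one_sub_ne_zero {q : ℂ} (hq : ‖q‖ < 1) (x : ℂ) (h : ∀ n : ℕ, q ^ (n + 1) * x ≠ 1) :
    ∏' n : ℕ, (1 - q ^ (n + 1) * x) ≠ 0 := by
  simp_rw [sub_eq_add_neg]
  refine tprod_one_add_ne_zero_of_summable (f := fun n : ℕ => -(q ^ (n + 1) * x)) ?_ ?_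
  · intro n hn
    exact h n (by linear_combination -hn)
  simp only [norm_neg, norm_mul, norm_pow]
  exact ((summable_nat_add_iff 1).2 (summable_geometric_of_lt_one (norm_nonneg _) hq)).mul_right _

theorem Theta_eq {τ : ℂ} (hτ : 0 < τ.im) (u : ℂ) :
    Theta u τ = ee (τ / 12) * (ee (u / 2) - ee (-u / 2)) *
      ((∏' n : ℕ, (1 - ee τ ^ (n + 1) * ee u)) * ∏' n : ℕ, (1 - ee τ ^ (n + 1) * (ee u)⁻¹)) := by
  rw [Theta, (multipliable_one_sub (norm_ee_lt_one hτ) _).tprod_mul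
    (multipliable_one_sub (norm_ee_lt_one hτ) _)]

theorem eq_zero_of_lin {a b : ℚ} {τ : ℍ} {m n : ℤ} (h : (a : ℂ) * τ + b = m * τ + n) :
    a = m ∧ b = n := by
  have him := congrArg Complex.im h
  simp only [Complex.add_im, Complex.mul_im, Complex.ratCast_re, Complex.ratCast_im,
    Complex.intCast_re, Complex.intCast_im, zero_mul, add_zero, coe_im] at him
  have ha : (a : ℝ) = m := mul_right_cancel₀ τ.im_pos.ne' him
  have ha' : a = m := by exact_mod_cast ha
  refine ⟨ha', ?_⟩
  rw [ha'] at h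
  have : (b : ℂ) = n := by
    push_cast at h
    exact add_left_cancel h
  exact_mod_cast this

theorem Theta_ne_zero (τ : ℍ) {a b : ℚ} (h : ¬ ∃ m n : ℤ, a = m ∧ b = n) :
    Theta (a * τ + b) τ ≠ 0 := by
  have key : ∀ m : ℤ, ee τ ^ m * ee (a * τ + b) ≠ 1 := by
    intro m hm
    rw [← ee_int_mul, ← ee_add, ee_eq_one_iff] at hm
    obtain ⟨n, hn⟩ := hm
    refine h ⟨-m, n, eq_zero_of_lin (τ := τ) ?_⟩
    push_cast
    linear_combination hn
  rw [Theta_eq τ.im_pos]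
  have hq := norm_ee_lt_one τ.im_pos
  refine mul_ne_zero (mul_ne_zero (ee_ne_zero _) ?_) (mul_ne_zero ?_ ?_)
  · intro h0
    apply key 0
    rw [zpow_zero, one_mul]
    have : ee (a * τ + b) = ee ((a * τ + b) / 2) * (ee (-(a * τ + b) / 2))⁻¹ := by
      rw [← ee_neg, ← ee_add]; congr 1; ring
    rw [this, sub_eq_zero.1 h0, mul_inv_cancel₀ (ee_ne_zero _)]
  · refine tprod_one_sub_ne_zero hq _ fun n hn => key (n + 1) ?_
    exact_mod_cast hn
  · refine tprod_one_sub_ne_zero hq _ fun n hn => key (-(n + 1)) ?_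
    have := congrArg Inv.inv hn
    rw [mul_inv, inv_inv, inv_one] at this
    rw [_root_.zpow_neg]
    exact_mod_cast this

theorem differentiableOn_tprod {g : ℂ → ℂ} (hg : DifferentiableOn ℂ g upperHalfPlaneSet) :
    DifferentiableOn ℂ (fun z => ∏' n : ℕ, (1 - ee z ^ (n + 1) * g z)) upperHalfPlaneSet := by
  have hU : IsOpen upperHalfPlaneSet := isOpen_upperHalfPlaneSet
  have hm : HasProdLocallyUniformlyOn (fun (n : ℕ) z => 1 - ee z ^ (n + 1) * g z)
      (fun z => ∏' n : ℕ, (1 - ee z ^ (n + 1) * g z)) upperHalfPlaneSet := by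
    simp_rw [sub_eq_add_neg]
    apply hasProdLocallyUniformlyOn_of_forall_compact hU
    intro K hK hcK
    rcases K.eq_empty_or_nonempty with hN | hN
    · simpa [hasProdUniformlyOn_iff_tendstoUniformlyOn, hN] using tendstoUniformlyOn_empty
    · obtain ⟨z₀, hz₀, _, HB⟩ := hcK.exists_sSup_image_eq_and_ge hN
        (show ContinuousOn (fun z : ℂ => ‖ee z‖) K from continuous_ee.norm.continuousOn)
      have hgK : ContinuousOn g K := hg.continuousOn.mono hK
      obtain ⟨C, hC⟩ := hcK.exists_bound_of_continuousOn hgK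
      have hr : ‖ee z₀‖ < 1 := norm_ee_lt_one (hK hz₀)
      refine (((summable_nat_add_iff 1).mpr (summable_geometric_of_lt_one (norm_nonneg _)
        hr)).mul_right C).hasProdUniformlyOn_nat_one_add hcK (.of_forall fun n x hx => ?_)
        (fun n => ((continuous_ee.continuousOn.pow _).mul hgK).neg)
      rw [norm_neg, norm_mul, norm_pow]
      exact mul_le_mul (pow_le_pow_left₀ (norm_nonneg _) (HB x hx) _) (hC x hx) (norm_nonneg _)
        (by positivity)
  refine hm.differentiableOn (.of_forall fun s => ?_) hU
  have : DifferentiableOn ℂ (fun z => ∏ n ∈ s, (1 - ee z ^ (n + 1) * g z)) upperHalfPlaneSet :=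
    DifferentiableOn.fun_finsetProd fun n _ =>
      ((differentiable_ee.differentiableOn.pow _).mul hg).const_sub 1
  exact this

theorem Theta_mem_Hol (a b : ℚ) : (fun τ : ℍ => Theta (a * τ + b) τ) ∈ Hol := by
  have hd : ∀ x y : ℂ, Differentiable ℂ fun z : ℂ => ee (x * z + y) := fun x y =>
    differentiable_ee.comp ((differentiable_id.const_mul x).add_const y)
  have h : DifferentiableOn ℂ (fun z : ℂ => ee (z / 12) * (ee ((a * z + b) / 2) -
      ee (-(a * z + b) / 2)) * ((∏' n : ℕ, (1 - ee z ^ (n + 1) * ee (a * z + b))) *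
        ∏' n : ℕ, (1 - ee z ^ (n + 1) * (ee (a * z + b))⁻¹))) upperHalfPlaneSet := by
    refine DifferentiableOn.mul (DifferentiableOn.mul ?_ (DifferentiableOn.sub ?_ ?_))
      (DifferentiableOn.mul ?_ ?_)
    · exact (differentiable_ee.comp (differentiable_id.div_const 12)).differentiableOn
    · exact (differentiable_ee.comp (((differentiable_id.const_mul (a : ℂ)).add_const
        (b : ℂ)).div_const 2)).differentiableOn
    · exact (differentiable_ee.comp (((differentiable_id.const_mul (a : ℂ)).add_const
        (b : ℂ)).neg.div_const 2)).differentiableOn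
    · exact differentiableOn_tprod (hd a b).differentiableOn
    · exact differentiableOn_tprod
        ((hd a b).differentiableOn.fun_inv fun z _ => ee_ne_zero _)
  refine h.congr fun z hz => ?_
  have hz' : ((ofComplex z : ℍ) : ℂ) = z := by
    rw [ofComplex_apply_of_im_pos hz]
  simp only [Function.comp, hz']
  exact Theta_eq hz _

theorem inv_mem_Hol {g : ℍ → ℂ} (hg : g ∈ Hol) (h0 : ∀ τ, g τ ≠ 0) : (fun τ => (g τ)⁻¹) ∈ Hol :=
  DifferentiableOn.inv hg fun _ _ => h0 _

/-- A nowhere vanishing holomorphic function as an element of `𝒪_ℋ^×`. -/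
def mkUnit (g : ℍ → ℂ) (hg : g ∈ Hol) (h0 : ∀ τ, g τ ≠ 0) : Holˣ where
  val := ⟨g, hg⟩
  inv := ⟨fun τ => (g τ)⁻¹, inv_mem_Hol hg h0⟩
  val_inv := Subtype.ext (funext fun τ => mul_inv_cancel₀ (h0 τ))
  inv_val := Subtype.ext (funext fun τ => inv_mul_cancel₀ (h0 τ))

/-- `v ∈ ℤ²`. -/
def IsIntegral (v : Fin 2 → ℚ) : Prop := ∃ m n : ℤ, v 0 = m ∧ v 1 = n

theorem ksFun_mem_Hol {c : ℕ} {v : Fin 2 → ℚ} (h : ¬ IsIntegral fun i => c * v i) :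
    ksFun c v ∈ Hol ∧ ∀ τ, ksFun c v τ ≠ 0 := by
  have h' : ¬ IsIntegral v := by
    rintro ⟨m, n, hm, hn⟩
    exact h ⟨c * m, c * n, by simp [hm], by simp [hn]⟩
  have e : ∀ τ : ℍ, Theta (c * (v 0 * τ + v 1)) τ =
      Theta (((c * v 0 : ℚ) : ℂ) * τ + ((c * v 1 : ℚ) : ℂ)) τ := by
    intro τ; congr 1; push_cast; ring
  have h1 : (fun τ : ℍ => Theta (c * (v 0 * τ + v 1)) τ) ∈ Hol := by
    simp_rw [e]; exact Theta_mem_Hol _ _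
  have h2 : ∀ τ : ℍ, Theta (c * (v 0 * τ + v 1)) τ ≠ 0 := by
    intro τ; rw [e]; exact Theta_ne_zero τ h
  refine ⟨?_, fun τ => mul_ne_zero (mul_ne_zero (by simp) (pow_ne_zero _ (Theta_ne_zero τ h')))
    (inv_ne_zero (h2 τ))⟩
  exact mul_mem (mul_mem (pow_mem (neg_mem (one_mem Hol)) _) (pow_mem (Theta_mem_Hol _ _) _))
    (inv_mem_Hol h1 h2)

open Classical in
/-- The Kato–Siegel unit `ϑ_c(aτ + b, τ) ∈ 𝒪_ℋ^×` attached to `v = (a, b)` with `c v ∉ ℤ²`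
(and the trivial unit `1` for the remaining `v`, which are never used). -/
def ksUnit (c : ℕ) (v : Fin 2 → ℚ) : Holˣ :=
  if h : IsIntegral fun i => c * v i then 1
  else mkUnit (ksFun c v) (ksFun_mem_Hol h).1 (ksFun_mem_Hol h).2

/-! The distribution relation `∏_{t w = v} ϑ_c(w) = ϑ_c(v)` for `t` prime to `c`. -/

theorem prod_range_one_sub {μ : ℂ} {t : ℕ} (ht : 0 < t) (h : IsPrimitiveRoot μ t) (x : ℂ) :
    ∏ j ∈ Finset.range t, (1 - x * μ ^ j) = 1 - x ^ t := by
  have h1 := h.pow_sub_pow_eq_prod_sub_mul (1 : ℂ) x ht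
  rw [one_pow] at h1
  rw [h1]
  have : NeZero t := ⟨ht.ne'⟩
  refine Finset.prod_bij (fun j _ => μ ^ j) ?_ ?_ ?_ ?_
  · intro j _
    rw [Polynomial.mem_nthRootsFinset ht, ← pow_mul, mul_comm, pow_mul, h.pow_eq_one, one_pow]
  · intro i hi j hj hij
    exact h.pow_inj (Finset.mem_range.1 hi) (Finset.mem_range.1 hj) hij
  · intro ξ hξ
    obtain ⟨i, hi, rfl⟩ := h.eq_pow_of_pow_eq_one ((Polynomial.mem_nthRootsFinset ht _).1 hξ)
    exact ⟨i, Finset.mem_range.2 hi, rfl⟩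
  · intro j _
    rw [mul_comm]

/-- `∏_{n ≥ 1} (1 - qⁿ x)`. -/
def eul (q x : ℂ) : ℂ := ∏' n : ℕ, (1 - q ^ (n + 1) * x)

theorem eul_mul {q : ℂ} (hq : ‖q‖ < 1) (x : ℂ) : eul q x = (1 - q * x) * eul q (q * x) := by
  rw [eul, tprod_eq_zero_mul']
  · rw [zero_add, pow_one, eul]
    congr 1
    refine tprod_congr fun n => ?_
    ring
  · refine (multipliable_one_sub hq (q * x)).congr fun n => ?_
    ring

/-- `F(x) = (1 - x) ∏_{n ≥ 1} (1 - qⁿ x)(1 - qⁿ x⁻¹)`. -/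
def thF (q x : ℂ) : ℂ := (1 - x) * eul q x * eul q x⁻¹

theorem thF_mul {q x : ℂ} (hq : ‖q‖ < 1) (hq0 : q ≠ 0) (hx : x ≠ 0) :
    thF q (q * x) = -x⁻¹ * thF q x := by
  have h1 := eul_mul hq x
  have h2 := eul_mul hq (q * x)⁻¹
  have e : q * (q * x)⁻¹ = x⁻¹ := by field_simp
  rw [e] at h2
  rw [thF, thF, h2, h1]
  field_simp
  ring

theorem prod_range_mul_eq {M : Type*} [CommMonoid M] (f : ℕ → M) (t m : ℕ) :
    ∏ n ∈ Finset.range (t * m), f n =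
      ∏ i ∈ Finset.range t, ∏ k ∈ Finset.range m, f (t * k + i) := by
  induction m with
  | zero => simp
  | succ m ih =>
    rw [Nat.mul_succ, Finset.prod_range_add, ih, ← Finset.prod_mul_distrib]
    refine Finset.prod_congr rfl fun i _ => ?_
    rw [Finset.prod_range_succ]

theorem tprod_residue {f : ℕ → ℂ} (hf : Multipliable f) {t : ℕ} (ht : 0 < t)
    (hf' : ∀ i, Multipliable fun k => f (t * k + i)) :
    ∏ i ∈ Finset.range t, ∏' k : ℕ, f (t * k + i) = ∏' n : ℕ, f n := by
  have h1 : Tendsto (fun m => ∏ n ∈ Finset.range (t * m), f n) atTop (nhds (∏' n, f n)) :=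
    hf.hasProd.tendsto_prod_nat.comp (tendsto_id.const_mul_atTop' ht)
  have h2 : Tendsto (fun m => ∏ i ∈ Finset.range t, ∏ k ∈ Finset.range m, f (t * k + i)) atTop
      (nhds (∏ i ∈ Finset.range t, ∏' k : ℕ, f (t * k + i))) :=
    tendsto_finsetProd _ fun i _ => (hf' i).hasProd.tendsto_prod_nat
  simp_rw [prod_range_mul_eq] at h1
  exact tendsto_nhds_unique h2 h1

theorem prod_eul {q : ℂ} (hq : ‖q‖ < 1) {t : ℕ} (ht : 0 < t) (x : ℂ) :
    ∏ i ∈ Finset.range t, eul (q ^ t) (q ^ i * x) * (1 - q ^ i * x) = eul q x * (1 - x) := by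
  have hqt : ‖q ^ t‖ < 1 := by
    rw [norm_pow]; exact pow_lt_one₀ (norm_nonneg _) hq ht.ne'
  have key : ∀ p y : ℂ, ‖p‖ < 1 → eul p y * (1 - y) = ∏' n : ℕ, (1 - p ^ n * y) := by
    intro p y hp
    have h := tprod_eq_zero_mul' (f := fun n : ℕ => 1 - p ^ n * y) (multipliable_one_sub hp y)
    rw [h, pow_zero, one_mul, mul_comm, eul]
  have m0 : ∀ (p y : ℂ), ‖p‖ < 1 → Multipliable fun n : ℕ => 1 - p ^ n * y := by
    intro p y hp
    simp_rw [sub_eq_add_neg]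
    refine multipliable_one_add_of_summable ?_
    simp only [norm_neg, norm_mul, norm_pow]
    exact (summable_geometric_of_lt_one (norm_nonneg _) hp).mul_right _
  rw [key q x hq, ← tprod_residue (m0 q x hq) ht]
  · refine Finset.prod_congr rfl fun i _ => ?_
    rw [key _ _ hqt]
    refine tprod_congr fun n => ?_
    rw [← pow_mul, ← mul_assoc, ← pow_add]
  · intro i
    refine (m0 (q ^ t) (q ^ i * x) hqt).congr fun n => ?_
    rw [← pow_mul, ← mul_assoc, ← pow_add]

theorem prod_eul_inv {q : ℂ} (hq : ‖q‖ < 1) (hq0 : q ≠ 0) {t : ℕ} (ht : 0 < t) (x : ℂ) :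
    ∏ i ∈ Finset.range t, eul (q ^ t) (q ^ i * x)⁻¹ = eul q x⁻¹ := by
  have hqt : ‖q ^ t‖ < 1 := by
    rw [norm_pow]; exact pow_lt_one₀ (norm_nonneg _) hq ht.ne'
  have e : ∀ i ∈ Finset.range t, ∀ k : ℕ, 1 - (q ^ t) ^ (k + 1) * (q ^ (t - 1 - i) * x)⁻¹ =
      1 - q ^ (t * k + i + 1) * x⁻¹ := by
    intro i hi k
    have hi' := Finset.mem_range.1 hi
    have : q ^ (t * k + i + 1) * q ^ (t - 1 - i) = (q ^ t) ^ (k + 1) := by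
      rw [← pow_add, ← pow_mul]; congr 1
      have : t - 1 - i + i + 1 = t := by omega
      rw [Nat.mul_succ]; omega
    rw [← this, mul_inv]
    have h0 : q ^ (t - 1 - i) ≠ 0 := pow_ne_zero _ hq0
    field_simp
  rw [← Finset.prod_range_reflect, eul, ← tprod_residue (multipliable_one_sub hq x⁻¹) ht]
  · refine Finset.prod_congr rfl fun i hi => ?_
    rw [eul]
    exact tprod_congr fun k => e i hi k
  · intro i
    refine (multipliable_one_sub hqt (q ^ i * q⁻¹ ^ t * q * x⁻¹)).congr fun k => ?_
    congr 1
    rw [inv_pow, ← pow_mul, Nat.mul_succ, pow_add, pow_succ, pow_add]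
    field_simp

theorem prod_thF {q : ℂ} (hq : ‖q‖ < 1) (hq0 : q ≠ 0) {t : ℕ} (ht : 0 < t) (x : ℂ) :
    ∏ i ∈ Finset.range t, thF (q ^ t) (q ^ i * x) = thF q x := by
  have h1 := prod_eul hq ht x
  have h2 := prod_eul_inv hq hq0 ht x
  rw [thF, mul_comm (1 - x), ← h1, ← h2, ← Finset.prod_mul_distrib]
  refine Finset.prod_congr rfl fun i _ => ?_
  rw [thF]; ring

theorem Theta_eq_thF {τ : ℂ} (hτ : 0 < τ.im) (u : ℂ) :
    Theta u τ = ee (τ / 12 + 1 / 2 - u / 2) * thF (ee τ) (ee u) := by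
  rw [Theta_eq hτ, thF, eul, eul, sub_eq_add_neg (_ + _ : ℂ), ee_add, ee_add, ee_half]
  have h : ee (u / 2) = ee (-u / 2) * ee u := by rw [← ee_add]; congr 1; ring
  rw [h, show -(u / 2) = -u / 2 by ring]
  ring

theorem ee_sum {ι : Type*} (s : Finset ι) (f : ι → ℂ) : ee (∑ i ∈ s, f i) = ∏ i ∈ s, ee (f i) := by
  classical
  induction s using Finset.induction_on with
  | empty => simp [ee_zero]
  | insert a s ha ih => rw [Finset.sum_insert ha, Finset.prod_insert ha, ee_add, ih]

/-- The product over the `j`'s. -/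
theorem prod_Theta_row {τ : ℂ} (hτ : 0 < τ.im) {c t : ℕ} (ht : 0 < t) (hct : c.Coprime t) (y : ℂ) :
    ∏ j ∈ Finset.range t, thF (ee τ) (ee (c * ((y + j) / t))) = thF (ee τ ^ t) (ee (c * y)) := by
  have htC : (t : ℂ) ≠ 0 := by exact_mod_cast ht.ne'
  have hμ : IsPrimitiveRoot (ee (c / t)) t :=
    Complex.isPrimitiveRoot_exp_of_coprime c t ht.ne' hct
  have hq := norm_ee_lt_one hτ
  have e1 : ∀ j : ℕ, ee (c * ((y + j) / t)) = ee (c * y / t) * ee (c / t) ^ j := by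
    intro j
    rw [← ee_nat_mul, ← ee_add]; congr 1; field_simp
  have e2 : ee (c * y / t) ^ t = ee (c * y) := by
    rw [← ee_nat_mul]; congr 1; field_simp
  have hE : ∀ (x μ : ℂ), IsPrimitiveRoot μ t →
      ∏ j ∈ Finset.range t, eul (ee τ) (x * μ ^ j) = eul (ee τ ^ t) (x ^ t) := by
    intro x μ h
    simp only [eul]
    rw [← Multipliable.tprod_finsetProd fun j _ => multipliable_one_sub hq (x * μ ^ j)]
    refine tprod_congr fun n => ?_
    simp_rw [← mul_assoc]
    rw [prod_range_one_sub ht h]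
    ring
  simp only [thF, Finset.prod_mul_distrib, e1]
  rw [prod_range_one_sub ht hμ, hE _ _ hμ, e2]
  congr 1
  simp_rw [mul_inv, ← inv_pow]
  rw [hE _ _ hμ.inv, inv_pow, e2]

theorem prod_periodic {c t : ℕ} (ht : 0 < t) (hct : c.Coprime t) (H : ℕ → ℂ)
    (hH : ∀ k, H (k + t) = H k) :
    ∏ i ∈ Finset.range t, H (c * i) = ∏ i ∈ Finset.range t, H i := by
  have hm : ∀ k, H (k % t) = H k := fun k => (show Function.Periodic H t from hH).map_mod_nat k
  refine Finset.prod_nbij (fun i => c * i % t) ?_ ?_ ?_ ?_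
  · intro i _
    exact Finset.mem_coe.2 (Finset.mem_range.2 (Nat.mod_lt _ ht))
  · intro i hi j hj hij
    have hi' := Finset.mem_range.1 (Finset.mem_coe.1 hi)
    have hj' := Finset.mem_range.1 (Finset.mem_coe.1 hj)
    have : i ≡ j [MOD t] := Nat.ModEq.cancel_left_of_coprime hct.symm hij
    rwa [Nat.ModEq, Nat.mod_eq_of_lt hi', Nat.mod_eq_of_lt hj'] at this
  · refine Finset.surjOn_of_injOn_of_card_le _ ?_ ?_ le_rfl
    · intro i _
      exact Finset.mem_coe.2 (Finset.mem_range.2 (Nat.mod_lt _ ht))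
    · intro i hi j hj hij
      have hi' := Finset.mem_range.1 (Finset.mem_coe.1 hi)
      have hj' := Finset.mem_range.1 (Finset.mem_coe.1 hj)
      have : i ≡ j [MOD t] := Nat.ModEq.cancel_left_of_coprime hct.symm hij
      rwa [Nat.ModEq, Nat.mod_eq_of_lt hi', Nat.mod_eq_of_lt hj'] at this
  · intro i _
    exact (hm _).symm

theorem sum_range_cast (t : ℕ) : ∑ i ∈ Finset.range t, (i : ℂ) = t * (t - 1) / 2 := by
  induction t with
  | zero => simp
  | succ t ih => rw [Finset.sum_range_succ, ih]; push_cast; ring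

theorem sum_range_sq_cast (t : ℕ) :
    ∑ i ∈ Finset.range t, (i : ℂ) ^ 2 = (t - 1) * t * (2 * t - 1) / 6 := by
  induction t with
  | zero => simp
  | succ t ih => rw [Finset.sum_range_succ, ih]; push_cast; ring

/-- The exponent of the automorphy factor of `∏ Θ(c w)` against `Θ(c u)`. -/
def expo (c t u τ : ℂ) : ℂ :=
  (t ^ 2 - 1) * τ / 12 + (t ^ 2 - 1) / 2 + c * u / 2 - c / 2 * (t * u + t * (t - 1) / 2 * (τ + 1)) +
    (c - 1) * (t * (t - 1) / 2) * (1 / (2 * t) - c * u / t + τ / 2) -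
      (c ^ 2 - 1) * ((t - 1) * t * (2 * t - 1) / 6) * τ / (2 * t)

theorem prod_Theta {τ : ℂ} (hτ : 0 < τ.im) {c t : ℕ} (ht : 0 < t) (hct : c.Coprime t) (u : ℂ) :
    ∏ i ∈ Finset.range t, ∏ j ∈ Finset.range t, Theta (c * ((u + i * τ + j) / t)) τ =
      Theta (c * u) τ * ee (expo c t u τ) := by
  have htC : (t : ℂ) ≠ 0 := by exact_mod_cast ht.ne'
  have hq := norm_ee_lt_one hτ
  have hq0 := ee_ne_zero τ
  have hqt : ‖ee τ ^ t‖ < 1 := by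
    rw [norm_pow]; exact pow_lt_one₀ (norm_nonneg _) hq ht.ne'
  let ψ : ℂ → ℂ := fun k => k / (2 * t) - k * (c * u) / t - (k ^ 2 / (2 * t) - k / 2) * τ
  let G : ℕ → ℂ := fun k => thF (ee τ ^ t) (ee τ ^ k * ee (c * u))
  let H : ℕ → ℂ := fun k => G k * ee (-ψ k)
  have hH : ∀ k, H (k + t) = H k := by
    intro k
    have hX : ee τ ^ k * ee (c * u) ≠ 0 := mul_ne_zero (pow_ne_zero _ hq0) (ee_ne_zero _)
    have h1 : G (k + t) = -(ee τ ^ k * ee (c * u))⁻¹ * G k := by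
      simp only [G]
      rw [← thF_mul hqt (pow_ne_zero _ hq0) hX]
      congr 1; ring
    have h2 : -(ee τ ^ k * ee (c * u))⁻¹ = ee (1 / 2 - k * τ - c * u) := by
      rw [← ee_nat_mul, ← ee_add, ← ee_neg, neg_eq_neg_one_mul, ← ee_half, ← ee_add]
      congr 1; ring
    simp only [H]
    rw [h1, h2, mul_right_comm, ← ee_add, mul_comm]
    congr 2
    simp only [ψ]
    push_cast
    field_simp
    ring
  have hG : ∀ k, G k = H k * ee (ψ k) := by
    intro k
    simp only [H]
    rw [mul_assoc, ← ee_add, neg_add_cancel, ee_zero, mul_one]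
  have hrow : ∀ i : ℕ, ∏ j ∈ Finset.range t, Theta (c * ((u + i * τ + j) / t)) τ =
      ee (∑ j ∈ Finset.range t, (τ / 12 + 1 / 2 - c * ((u + i * τ + j) / t) / 2)) * G (c * i) := by
    intro i
    simp_rw [Theta_eq_thF hτ]
    rw [Finset.prod_mul_distrib, prod_Theta_row hτ ht hct, ← ee_sum]
    congr 2
    rw [← ee_nat_mul, ← ee_add]; congr 1; push_cast; ring
  simp_rw [hrow]
  rw [Finset.prod_mul_distrib, ← ee_sum]
  simp_rw [hG]
  rw [Finset.prod_mul_distrib, prod_periodic ht hct H hH, ← ee_sum]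
  have hF : thF (ee τ) (ee (c * u)) =
      (∏ i ∈ Finset.range t, H i) * ee (∑ i ∈ Finset.range t, ψ i) := by
    rw [← prod_thF hq hq0 ht, ee_sum, ← Finset.prod_mul_distrib]
    exact Finset.prod_congr rfl fun i _ => hG i
  rw [Theta_eq_thF hτ, hF]
  have hexp : (∑ i ∈ Finset.range t, ∑ j ∈ Finset.range t,
      (τ / 12 + 1 / 2 - c * ((u + i * τ + j) / t) / 2)) + ∑ i ∈ Finset.range t, ψ ((c * i : ℕ) : ℂ) =
      (τ / 12 + 1 / 2 - c * u / 2) + (∑ i ∈ Finset.range t, ψ i) + expo c t u τ := by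
    have r1 : ∀ i j : ℂ, τ / 12 + 1 / 2 - c * ((u + i * τ + j) / t) / 2 =
        (τ / 12 + 1 / 2 - c * u / (2 * t)) + i * (-(c * τ / (2 * t))) + j * (-(c / (2 * t))) := by
      intro i j; field_simp; ring
    have r2 : ∀ k : ℂ, ψ k = k * (1 / (2 * t) - c * u / t + τ / 2) + k ^ 2 * (-(τ / (2 * t))) := by
      intro k; simp only [ψ]; field_simp; ring
    simp_rw [r1, r2, Finset.sum_add_distrib, ← Finset.sum_mul, Finset.sum_const, Finset.card_range,
      nsmul_eq_mul]
    push_cast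
    simp_rw [mul_pow, ← Finset.mul_sum, sum_range_cast, sum_range_sq_cast]
    simp only [expo]
    field_simp
    ring
  calc _ = (∏ i ∈ Finset.range t, H i) * ee ((∑ i ∈ Finset.range t, ∑ j ∈ Finset.range t,
      (τ / 12 + 1 / 2 - c * ((u + i * τ + j) / t) / 2)) +
        ∑ i ∈ Finset.range t, ψ ((c * i : ℕ) : ℂ)) := by rw [ee_add]; ring
    _ = _ := by rw [hexp, ee_add, ee_add]; ring

theorem ksFun_relation {c t : ℕ} (hc : Odd c) (ht : 0 < t) (hct : c.Coprime t) (v : Fin 2 → ℚ)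
    (τ : ℍ) :
    ∏ i ∈ Finset.range t, ∏ j ∈ Finset.range t, ksFun c ![(v 0 + i) / t, (v 1 + j) / t] τ =
      ksFun c v τ := by
  obtain ⟨m, rfl⟩ := hc
  have htC : (t : ℂ) ≠ 0 := by exact_mod_cast ht.ne'
  set u : ℂ := v 0 * τ + v 1 with hu
  have e : ∀ i j : ℕ, ksFun (2 * m + 1) ![(v 0 + i) / t, (v 1 + j) / t] τ =
      (-1) ^ m * Theta ((1 : ℕ) * ((u + i * τ + j) / t)) τ ^ (2 * m + 1) ^ 2 *
        (Theta ((2 * m + 1 : ℕ) * ((u + i * τ + j) / t)) τ)⁻¹ := by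
    intro i j
    have : ((![(v 0 + i) / t, (v 1 + j) / t] 0 : ℚ) : ℂ) * τ +
        ((![(v 0 + i) / t, (v 1 + j) / t] 1 : ℚ) : ℂ) = (u + i * τ + j) / t := by
      simp only [Matrix.cons_val_zero, Matrix.cons_val_one, hu]
      push_cast
      ring
    rw [ksFun, this, show (2 * m + 1 - 1) / 2 = m by omega, Nat.cast_one, one_mul]
  simp_rw [e, Finset.prod_mul_distrib, Finset.prod_pow, Finset.prod_inv_distrib,
    prod_Theta τ.im_pos ht hct, prod_Theta τ.im_pos ht (Nat.coprime_one_left t)]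
  simp only [Finset.prod_const, Finset.card_range]
  rw [ksFun, ← hu, show (2 * m + 1 - 1) / 2 = m by omega, mul_pow, mul_inv, Nat.cast_one, one_mul,
    ← ee_nat_mul, ← ee_neg]
  have key : ee ((t * (t * (m * (1 / 2))) : ℂ)) * ee (((2 * m + 1) ^ 2 : ℕ) * expo 1 t u τ) *
      ee (-expo (2 * m + 1 : ℕ) t u τ) = ee (m * (1 / 2)) := by
    rw [← ee_add, ← ee_add]
    have : (t * (t * (m * (1 / 2))) : ℂ) + ((2 * m + 1) ^ 2 : ℕ) * expo 1 t u τ +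
        -expo (2 * m + 1 : ℕ) t u τ =
        m * (1 / 2) + ((2 * m * (m + 1) * (t ^ 2 - 1) - m ^ 2 * t * (t - 1) : ℤ) : ℂ) := by
      simp only [expo]
      push_cast
      field_simp
      ring
    rw [this, ee_add, ee_int, mul_one]
  rw [ee_nat_mul t, ee_nat_mul t, ee_nat_mul m, ee_half] at key
  linear_combination (Theta u τ ^ (2 * m + 1) ^ 2 * (Theta ((2 * m + 1 : ℕ) * u) τ)⁻¹) * key

/-! Every adelic test function has a level: it is `m ℤ²`-periodic on `ℚ²` and supported on
`m⁻¹ ℤ²`, for some `m` prime to the primes of `S`. -/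

theorem exists_localScale {ℓ : ℕ} [Fact ℓ.Prime] {f : (Fin 2 → ℚ_[ℓ]) → ℤ} (hf : IsLocalTest ℓ f) :
    ∃ n : ℕ, (∀ v w : Fin 2 → ℚ_[ℓ], (∀ i, ‖w i‖ ≤ 1) →
      f (fun i => v i + (ℓ : ℚ_[ℓ]) ^ n * w i) = f v) ∧
      ∀ v, f v ≠ 0 → ∀ i, ‖(ℓ : ℚ_[ℓ]) ^ n * v i‖ ≤ 1 := by
  have hℓ : (1 : ℝ) < ℓ := by exact_mod_cast (Fact.out : ℓ.Prime).one_lt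
  have hinv : (ℓ : ℝ)⁻¹ < 1 := inv_lt_one_of_one_lt₀ hℓ
  have huc := hf.2.uniformContinuous_of_continuous hf.1.continuous
  obtain ⟨ε, hε, H⟩ := Metric.uniformContinuous_iff.1 huc 1 one_pos
  obtain ⟨n₁, hn₁⟩ := exists_pow_lt_of_lt_one hε hinv
  obtain ⟨C, hC⟩ := hf.2.isCompact.isBounded.exists_norm_le
  have hC' : 0 < (|C| + 1)⁻¹ := by positivity
  obtain ⟨n₂, hn₂⟩ := exists_pow_lt_of_lt_one hC' hinv
  have hnorm : ∀ k : ℕ, ‖(ℓ : ℚ_[ℓ]) ^ k‖ = (ℓ : ℝ)⁻¹ ^ k := fun k => by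
    rw [norm_pow, Padic.norm_p]
  have hpos : (0 : ℝ) ≤ (ℓ : ℝ)⁻¹ := by positivity
  refine ⟨max n₁ n₂, fun v w hw => ?_, fun v hv i => ?_⟩
  · have hd : dist (fun i => v i + (ℓ : ℚ_[ℓ]) ^ (max n₁ n₂) * w i) v < ε := by
      rw [dist_pi_lt_iff hε]
      intro i
      rw [dist_eq_norm, add_sub_cancel_left, norm_mul, hnorm]
      refine lt_of_le_of_lt ?_ hn₁
      refine (mul_le_of_le_one_right (pow_nonneg hpos _) (hw i)).trans ?_
      exact pow_le_pow_of_le_one hpos hinv.le (le_max_left _ _)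
    have := H hd
    rw [Int.dist_eq] at this
    have h2 : |f (fun i => v i + (ℓ : ℚ_[ℓ]) ^ (max n₁ n₂) * w i) - f v| < 1 := by exact_mod_cast this
    have := Int.abs_lt_one_iff.1 h2
    omega
  · have hv1 : ‖v‖ ≤ C := hC v (subset_tsupport f hv)
    have hv2 : ‖v i‖ ≤ |C| + 1 := by
      have := norm_le_pi_norm v i
      have := le_abs_self C
      linarith
    rw [norm_mul, hnorm]
    have h3 : (ℓ : ℝ)⁻¹ ^ (max n₁ n₂) ≤ (|C| + 1)⁻¹ :=
      (pow_le_pow_of_le_one hpos hinv.le (le_max_right _ _)).trans hn₂.le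
    calc _ ≤ (|C| + 1)⁻¹ * (|C| + 1) := mul_le_mul h3 hv2 (norm_nonneg _) hC'.le
      _ = 1 := inv_mul_cancel₀ (by positivity)

/-- The local conditions expressing that `m` is a level of `f`. -/
def IsLocalScale (ℓ : ℕ) [Fact ℓ.Prime] (f : (Fin 2 → ℚ_[ℓ]) → ℤ) (m : ℕ) : Prop :=
  (∀ v w : Fin 2 → ℚ_[ℓ], (∀ i, ‖w i‖ ≤ 1) → f (fun i => v i + (m : ℚ_[ℓ]) * w i) = f v) ∧
    ∀ v, f v ≠ 0 → ∀ i, ‖(m : ℚ_[ℓ]) * v i‖ ≤ 1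

theorem IsLocalScale.mul {ℓ : ℕ} [Fact ℓ.Prime] {f : (Fin 2 → ℚ_[ℓ]) → ℤ} {m : ℕ}
    (h : IsLocalScale ℓ f m) (k : ℕ) : IsLocalScale ℓ f (m * k) := by
  have hk : ‖(k : ℚ_[ℓ])‖ ≤ 1 := by exact_mod_cast Padic.norm_int_le_one (p := ℓ) k
  refine ⟨fun v w hw => ?_, fun v hv i => ?_⟩
  · have := h.1 v (fun i => k * w i) fun i => by
      rw [norm_mul]; exact mul_le_one₀ hk (norm_nonneg _) (hw i)
    rw [← this]
    congr 1
    funext i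
    push_cast
    ring
  · have := h.2 v hv i
    rw [Nat.cast_mul, mul_right_comm, norm_mul]
    exact mul_le_one₀ this (norm_nonneg _) hk

theorem isLocalScale_unitBox (ℓ : ℕ) [Fact ℓ.Prime] : IsLocalScale ℓ (unitBox ℓ) 1 := by
  constructor
  · intro v w hw
    have : (∀ i, ‖v i + ((1 : ℕ) : ℚ_[ℓ]) * w i‖ ≤ 1) ↔ ∀ i, ‖v i‖ ≤ 1 := by
      refine forall_congr' fun i => ⟨fun h => ?_, fun h => ?_⟩
      · have e : v i = (v i + ((1 : ℕ) : ℚ_[ℓ]) * w i) + -(w i) := by push_cast; ring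
        rw [e]
        exact (Padic.nonarchimedean _ _).trans (max_le h (by rw [norm_neg]; exact hw i))
      · rw [Nat.cast_one, one_mul]
        exact (Padic.nonarchimedean _ _).trans (max_le h (hw i))
    simp only [unitBox, this]
  · intro v hv i
    have : ∀ i, ‖v i‖ ≤ 1 := by
      by_contra h
      exact hv (if_neg h)
    simpa using this i

/-- `m` is a level of the `S`-adelic function `F`, restricted to rational vectors. -/
def IsScale {S : Set ℕ} (F : (Fin 2 → Adele S) → ℤ) (m : ℕ) : Prop :=
  (∀ (v : Fin 2 → ℚ) (w : Fin 2 → ℤ),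
    F (fun i => diag S (v i + m * w i)) = F (fun i => diag S (v i))) ∧
    ∀ v : Fin 2 → ℚ, F (fun i => diag S (v i)) ≠ 0 →
      ∀ (ℓ : Off S) (i : Fin 2), ‖((m * v i : ℚ) : ℚ_[(ℓ : ℕ)])‖ ≤ 1

theorem IsScale.mul {S : Set ℕ} {F : (Fin 2 → Adele S) → ℤ} {m : ℕ} (h : IsScale F m) (k : ℕ) :
    IsScale F (m * k) := by
  refine ⟨fun v w => ?_, fun v hv ℓ i => ?_⟩
  · rw [← h.1 v fun i => k * w i]
    congr 1
    funext i
    congr 1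
    push_cast
    ring
  · have hk : ‖((k : ℚ) : ℚ_[(ℓ : ℕ)])‖ ≤ 1 := by
      exact_mod_cast Padic.norm_int_le_one (p := (ℓ : ℕ)) k
    have e : ((m * k : ℕ) : ℚ) * v i = (m * v i) * k := by push_cast; ring
    rw [e, Rat.cast_mul, norm_mul]
    exact mul_le_one₀ (h.2 v hv ℓ i) (norm_nonneg _) hk

theorem exists_scale {S : Set ℕ} {F : (Fin 2 → Adele S) → ℤ} (hF : F ∈ testFn S) :
    ∃ m : ℕ, 0 < m ∧ (∀ ℓ ∈ S, ℓ.Prime → ¬ ℓ ∣ m) ∧ IsScale F m := by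
  induction hF using AddSubgroup.closure_induction with
  | mem F hF =>
    obtain ⟨f, hf, rfl⟩ := hF
    choose n hn using fun ℓ : Off S => exists_localScale (hf.1 ℓ)
    have hfin := Filter.eventually_cofinite.1 hf.2
    have hloc : ∀ ℓ : Off S, IsLocalScale (ℓ : ℕ) (f ℓ) (∏ p ∈ hfin.toFinset, (p : ℕ) ^ n p) := by
      intro ℓ
      by_cases hℓ : f ℓ = unitBox (ℓ : ℕ)
      · rw [hℓ]
        simpa using (isLocalScale_unitBox (ℓ : ℕ)).mul (∏ p ∈ hfin.toFinset, (p : ℕ) ^ n p)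
      · have hmem : ℓ ∈ hfin.toFinset := by simpa using hℓ
        rw [← Finset.mul_prod_erase _ _ hmem]
        refine IsLocalScale.mul ⟨fun v w hw => ?_, fun v hv i => ?_⟩ _
        · have := (hn ℓ).1 v w hw
          push_cast
          exact this
        · have := (hn ℓ).2 v hv i
          push_cast
          exact this
    refine ⟨∏ p ∈ hfin.toFinset, (p : ℕ) ^ n p, ?_, ?_, ?_, ?_⟩
    · exact Finset.prod_pos fun p _ => pow_pos p.2.1.pos _
    · intro ℓ hℓS hℓ hdvd
      obtain ⟨p, _, hp⟩ := (Prime.dvd_finsetProd_iff hℓ.prime _).1 hdvd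
      have := (Nat.prime_dvd_prime_iff_eq hℓ p.2.1).1 (hℓ.dvd_of_dvd_pow hp)
      exact p.2.2 (this ▸ hℓS)
    · intro v w
      refine finprod_congr fun ℓ => ?_
      have := (hloc ℓ).1 (fun i => (v i : ℚ_[(ℓ : ℕ)])) (fun i => (w i : ℚ_[(ℓ : ℕ)]))
        fun i => Padic.norm_int_le_one _
      refine Eq.trans ?_ this
      congr 1
    · intro v hv ℓ i
      have hne : f ℓ (fun i => diag S (v i) ℓ) ≠ 0 := by
        intro h0
        apply hv
        have hsup := hf.finite_mulSupport fun i => diag S (v i)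
        rw [tensor, finprod_eq_prod _ hsup]
        refine Finset.prod_eq_zero (i := ℓ) ?_ h0
        rw [Set.Finite.mem_toFinset, Function.mem_mulSupport, h0]
        exact zero_ne_one
      have := (hloc ℓ).2 _ hne i
      rw [diag_apply] at this
      rw [Rat.cast_mul, Rat.cast_natCast]
      exact this
  | zero => exact ⟨1, one_pos, fun ℓ _ hℓ h => hℓ.one_lt.ne' (Nat.dvd_one.1 h), fun _ _ => rfl,
      fun v hv => absurd rfl hv⟩
  | add F G _ _ hF hG =>
    obtain ⟨m, hm, hmS, h1⟩ := hF
    obtain ⟨k, hk, hkS, h2⟩ := hG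
    refine ⟨m * k, Nat.mul_pos hm hk, fun ℓ hS hℓ h => (hℓ.dvd_mul.1 h).elim (hmS ℓ hS hℓ)
      (hkS ℓ hS hℓ), ?_⟩
    have h1' := h1.mul k
    have h2' := h2.mul m
    rw [mul_comm] at h2'
    refine ⟨fun v w => by rw [Pi.add_apply, Pi.add_apply, h1'.1, h2'.1], fun v hv => ?_⟩
    by_cases h0 : F (fun i => diag S (v i)) = 0
    · refine h2'.2 v fun h3 => hv ?_
      rw [Pi.add_apply, h0, h3, add_zero]
    · exact h1'.2 v h0
  | neg F _ hF =>
    obtain ⟨m, hm, hmS, h1⟩ := hF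
    refine ⟨m, hm, hmS, fun v w => by rw [Pi.neg_apply, Pi.neg_apply, h1.1], fun v hv => ?_⟩
    exact h1.2 v fun h0 => hv (by rw [Pi.neg_apply, h0, neg_zero])

/-- `f : ℚ² → ℤ` is `t ℤ²`-periodic. -/
def IsPeriod (f : (Fin 2 → ℚ) → ℤ) (t : ℕ) : Prop :=
  ∀ (v : Fin 2 → ℚ) (w : Fin 2 → ℤ), f (fun i => v i + t * w i) = f v

/-- The support of `f : ℚ² → ℤ` is contained in `d⁻¹ ℤ²`. -/
def IsDenom (f : (Fin 2 → ℚ) → ℤ) (d : ℕ) : Prop :=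
  ∀ v : Fin 2 → ℚ, f v ≠ 0 → ∃ w : Fin 2 → ℤ, ∀ i, d * v i = w i

open Classical in
theorem toRat_apply {S : Set ℕ} (F : testFn₀ S) (v : Fin 2 → ℚ) :
    toRat F v = if ∀ ℓ : Off ∅, (ℓ : ℕ) ∈ S → ∀ i, ‖((v i : ℚ) : ℚ_[(ℓ : ℕ)])‖ ≤ 1
      then F.1 (fun i => diag S (v i)) else 0 := rfl

theorem exists_int_of_norm_le_one {x : ℚ}
    (h : ∀ ℓ : ℕ, [Fact ℓ.Prime] → ‖(x : ℚ_[ℓ])‖ ≤ 1) : ∃ n : ℤ, x = n := by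
  refine ⟨x.num, (Rat.den_eq_one_iff x).1 ?_ |>.symm⟩
  by_contra hne
  obtain ⟨p, hp, hdvd⟩ := Nat.exists_prime_and_dvd hne
  have : Fact p.Prime := ⟨hp⟩
  have hu := PadicInt.isUnit_den x (h p)
  rw [PadicInt.isUnit_iff, PadicInt.norm_def] at hu
  have hlt : ‖((x.den : ℕ) : ℚ_[p])‖ < 1 := Padic.norm_natCast_lt_one_iff.2 hdvd
  have hu' : ‖((x.den : ℕ) : ℚ_[p])‖ = 1 := by simpa using hu
  exact absurd hu' hlt.ne

theorem exists_level {S : Set ℕ} (F : testFn₀ S) :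
    ∃ m : ℕ, 0 < m ∧ (∀ ℓ ∈ S, ℓ.Prime → ¬ ℓ ∣ m) ∧ IsPeriod (toRat F) m ∧ IsDenom (toRat F) m := by
  obtain ⟨m, hm, hmS, h1, h2⟩ := exists_scale F.2.1
  have hmn : ∀ (ℓ : Off ∅) (w : ℤ), ‖((m * w : ℚ) : ℚ_[(ℓ : ℕ)])‖ ≤ 1 := by
    intro ℓ w
    have := Padic.norm_int_le_one (p := (ℓ : ℕ)) (m * w)
    push_cast at this ⊢
    exact this
  refine ⟨m, hm, hmS, ?_, ?_⟩
  · intro v w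
    have : (∀ ℓ : Off ∅, (ℓ : ℕ) ∈ S → ∀ i, ‖((v i + m * w i : ℚ) : ℚ_[(ℓ : ℕ)])‖ ≤ 1) ↔
        ∀ ℓ : Off ∅, (ℓ : ℕ) ∈ S → ∀ i, ‖((v i : ℚ) : ℚ_[(ℓ : ℕ)])‖ ≤ 1 := by
      refine forall_congr' fun ℓ => forall_congr' fun _ => forall_congr' fun i => ?_
      constructor
      · intro h
        have e : v i = (v i + m * w i) + -(m * w i) := by ring
        rw [e, Rat.cast_add]
        exact (Padic.nonarchimedean _ _).trans
          (max_le h (by rw [Rat.cast_neg, norm_neg]; exact hmn ℓ (w i)))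
      · intro h
        rw [Rat.cast_add]
        exact (Padic.nonarchimedean _ _).trans (max_le h (hmn ℓ (w i)))
    rw [toRat_apply, toRat_apply, h1]
    classical exact if_congr this rfl rfl
  · intro v hv
    rw [toRat_apply] at hv
    split_ifs at hv with hS
    · refine Classical.skolem.1 fun i => exists_int_of_norm_le_one fun ℓ hℓ => ?_
      by_cases hmem : ℓ ∈ S
      · rw [Rat.cast_mul, norm_mul]
        refine mul_le_one₀ ?_ (norm_nonneg _) (hS ⟨ℓ, hℓ.out, Set.notMem_empty _⟩ hmem i)
        exact_mod_cast Padic.norm_int_le_one (p := ℓ) m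
      · exact h2 v hv ⟨ℓ, hℓ.out, hmem⟩ i
    · exact absurd rfl hv

theorem toRat_zero {S : Set ℕ} (F : testFn₀ S) : toRat F 0 = 0 := by
  have h0 : (fun i => diag ∅ ((0 : Fin 2 → ℚ) i)) = 0 := by
    funext i; exact map_zero _
  rw [toRat, h0]
  exact (extend (Set.empty_subset S) F).2.2

theorem toRat_add {S : Set ℕ} (F G : testFn₀ S) : toRat (F + G) = toRat F + toRat G := by
  funext v
  rw [toRat, map_add]
  rfl

/-! ### The Kato–Siegel distribution -/

/-- For a `t ℤ²`-periodic `f : ℚ² → ℤ`, so that `f(t ·) = ∑_v f(t v) [v + ℤ²]` over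
`v ∈ ℚ²/ℤ²`: the product `∏_v ϑ_c(v)^{f(t v)}`, with the classes `v` represented in `[0, 1)²`. -/
def ksValue (c t : ℕ) (f : (Fin 2 → ℚ) → ℤ) : Holˣ :=
  ∏ᶠ v ∈ {v : Fin 2 → ℚ | ∀ i, 0 ≤ v i ∧ v i < 1}, ksUnit c v ^ f (fun i => t * v i)

theorem ksValue_eq {c t d m : ℕ} {f : (Fin 2 → ℚ) → ℤ} (hd : IsDenom f d) (hm : m = d * t)
    (hm0 : 0 < m) :
    ksValue c t f = ∏ i ∈ Finset.range m, ∏ j ∈ Finset.range m,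
      ksUnit c ![(i : ℚ) / m, (j : ℚ) / m] ^ f ![t * ((i : ℚ) / m), t * ((j : ℚ) / m)] := by
  classical
  have hmQ : (0 : ℚ) < m := by exact_mod_cast hm0
  let e : ℕ × ℕ → (Fin 2 → ℚ) := fun p => ![(p.1 : ℚ) / m, (p.2 : ℚ) / m]
  have he : Function.Injective e := by
    intro p p' h
    have h0 := congrFun h 0
    have h1 := congrFun h 1
    simp only [e, Matrix.cons_val_zero, Matrix.cons_val_one, div_left_inj' hmQ.ne'] at h0 h1
    exact Prod.ext (by exact_mod_cast h0) (by exact_mod_cast h1)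
  rw [← Finset.prod_product']
  have hvec : ∀ p : ℕ × ℕ, (fun i => (t : ℚ) * e p i) =
      ![t * ((p.1 : ℚ) / m), t * ((p.2 : ℚ) / m)] := by
    intro p
    funext i
    fin_cases i <;> rfl
  rw [ksValue, finprod_mem_eq_prod_of_subset
    (t := (Finset.range m ×ˢ Finset.range m).image e), Finset.prod_image he.injOn]
  · refine Finset.prod_congr rfl fun p _ => ?_
    rw [hvec]
  · rintro v ⟨hv, hsupp⟩
    have hne : f (fun i => t * v i) ≠ 0 := by
      intro h0
      apply hsupp
      simp only [h0, zpow_zero]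
    obtain ⟨w, hw⟩ := hd _ hne
    have hmw : ∀ i, (m : ℚ) * v i = w i := by
      intro i; rw [← hw i, hm]; push_cast; ring
    have hvi : ∀ i, v i = (w i).toNat / m ∧ (w i).toNat < m := by
      intro i
      have h0 : 0 ≤ w i := by
        have : (0 : ℚ) ≤ w i := by rw [← hmw i]; exact mul_nonneg hmQ.le (hv i).1
        exact_mod_cast this
      have h1 : w i < m := by
        have : (w i : ℚ) < m := by rw [← hmw i]; exact mul_lt_of_lt_one_right hmQ (hv i).2
        exact_mod_cast this
      refine ⟨?_, by omega⟩
      have h2 : (((w i).toNat : ℤ) : ℚ) = w i := by rw [Int.toNat_of_nonneg h0]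
      rw [Int.cast_natCast] at h2
      rw [h2, ← hmw i]
      field_simp
    refine Finset.mem_coe.2 (Finset.mem_image.2 ⟨((w 0).toNat, (w 1).toNat), ?_, ?_⟩)
    · exact Finset.mem_product.2 ⟨Finset.mem_range.2 (hvi 0).2, Finset.mem_range.2 (hvi 1).2⟩
    · funext i
      fin_cases i
      · exact (hvi 0).1.symm
      · exact (hvi 1).1.symm
  · intro v hv
    obtain ⟨p, hp, rfl⟩ := Finset.mem_image.1 (Finset.mem_coe.1 hv)
    obtain ⟨h1, h2⟩ := Finset.mem_product.1 hp
    have h1' : (p.1 : ℚ) < m := by exact_mod_cast Finset.mem_range.1 h1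
    have h2' : (p.2 : ℚ) < m := by exact_mod_cast Finset.mem_range.1 h2
    intro i
    fin_cases i
    · exact ⟨div_nonneg (by positivity) hmQ.le, (div_lt_one hmQ).2 h1'⟩
    · exact ⟨div_nonneg (by positivity) hmQ.le, (div_lt_one hmQ).2 h2'⟩

theorem ksUnit_relation {c s : ℕ} (hc : Odd c) (hs : 0 < s) (hcs : c.Coprime s) {v : Fin 2 → ℚ}
    (hv : ¬ IsIntegral fun i => c * v i) :
    ∏ k ∈ Finset.range s, ∏ l ∈ Finset.range s, ksUnit c ![(v 0 + k) / s, (v 1 + l) / s] =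
      ksUnit c v := by
  have hsQ : (s : ℚ) ≠ 0 := by exact_mod_cast hs.ne'
  let ev : ℍ → Holˣ →* ℂ := fun τ =>
    ((Pi.evalRingHom (fun _ : ℍ => ℂ) τ).comp Hol.subtype : Hol →* ℂ).comp (Units.coeHom Hol)
  have hev : ∀ (τ : ℍ) (w : Fin 2 → ℚ), (¬ IsIntegral fun i => c * w i) →
      ev τ (ksUnit c w) = ksFun c w τ := by
    intro τ w hw
    rw [ksUnit, dif_neg hw]
    rfl
  have hw : ∀ k l : ℕ, ¬ IsIntegral fun i => c * ![(v 0 + k) / s, (v 1 + l) / s] i := by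
    rintro k l ⟨m, n, hm, hn⟩
    simp only [Matrix.cons_val_zero, Matrix.cons_val_one] at hm hn
    refine hv ⟨s * m - c * k, s * n - c * l, ?_, ?_⟩
    · push_cast
      rw [← hm]; field_simp; ring
    · push_cast
      rw [← hn]; field_simp; ring
  apply Units.ext
  apply Subtype.ext
  funext τ
  change ev τ _ = ev τ _
  simp_rw [map_prod, hev τ _ (hw _ _), hev τ _ hv]
  exact ksFun_relation hc hs hcs v τ

theorem ksValue_mul {c t d s : ℕ} {f : (Fin 2 → ℚ) → ℤ} (hc : Odd c) (ht : 0 < t) (hs : 0 < s)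
    (hd : 0 < d) (hct : c.Coprime t) (hcd : c.Coprime d) (hcs : c.Coprime s) (hf0 : f 0 = 0)
    (hper : IsPeriod f t) (hden : IsDenom f d) :
    ksValue c (t * s) f = ksValue c t f := by
  have hm0 : 0 < d * t := Nat.mul_pos hd ht
  have hcm : c.Coprime (d * t) := hcd.mul_right hct
  rw [ksValue_eq hden rfl hm0, ksValue_eq (m := d * t * s) hden (by ring) (Nat.mul_pos hm0 hs)]
  generalize hm : d * t = m at hm0 hcm
  have hmQ : (m : ℚ) ≠ 0 := by exact_mod_cast hm0.ne'
  have hsQ : (s : ℚ) ≠ 0 := by exact_mod_cast hs.ne'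
  rw [prod_range_mul_eq]
  refine Finset.prod_congr rfl fun i hi => ?_
  simp_rw [prod_range_mul_eq]
  rw [Finset.prod_comm]
  refine Finset.prod_congr rfl fun j hj => ?_
  have e1 : ∀ k l : ℕ, (![((m * k + i : ℕ) : ℚ) / (m * s : ℕ), ((m * l + j : ℕ) : ℚ) / (m * s : ℕ)]
      : Fin 2 → ℚ) = ![((i : ℚ) / m + k) / s, ((j : ℚ) / m + l) / s] := by
    intro k l
    push_cast
    congr 1
    · field_simp; ring
    · congr 1
      field_simp; ring
  have e2 : ∀ k l : ℕ, f ![((t * s : ℕ) : ℚ) * (((m * k + i : ℕ) : ℚ) / (m * s : ℕ)),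
      ((t * s : ℕ) : ℚ) * (((m * l + j : ℕ) : ℚ) / (m * s : ℕ))] =
      f ![t * ((i : ℚ) / m), t * ((j : ℚ) / m)] := by
    intro k l
    rw [← hper ![t * ((i : ℚ) / m), t * ((j : ℚ) / m)] ![k, l]]
    congr 1
    funext r
    fin_cases r
    · simp only [Fin.zero_eta, Matrix.cons_val_zero]
      push_cast; field_simp; ring
    · simp only [Fin.mk_one, Matrix.cons_val_one]
      push_cast; field_simp; ring
  simp_rw [e1, e2]
  simp_rw [Finset.prod_zpow]
  by_cases hint : IsIntegral fun r => c * (![(i : ℚ) / m, (j : ℚ) / m] : Fin 2 → ℚ) r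
  · have key : ∀ a : ℕ, a < m → (∃ n : ℤ, c * ((a : ℚ) / m) = n) → a = 0 := by
      rintro a ha ⟨n, hn⟩
      have h1 : (c : ℚ) * a = n * m := by
        rw [← hn]; field_simp
      have h2 : (c : ℤ) * a = n * m := by exact_mod_cast h1
      have h3 : (m : ℤ) ∣ c * a := ⟨n, by rw [h2]; ring⟩
      have h4 : m ∣ a := hcm.symm.dvd_of_dvd_mul_left (by exact_mod_cast h3)
      exact Nat.eq_zero_of_dvd_of_lt h4 ha
    obtain ⟨n, n', hn, hn'⟩ := hint
    have hi0 := key i (Finset.mem_range.1 hi) ⟨n, by simpa using hn⟩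
    have hj0 := key j (Finset.mem_range.1 hj) ⟨n', by simpa using hn'⟩
    have hz : (![(t : ℚ) * ((i : ℚ) / m), t * ((j : ℚ) / m)] : Fin 2 → ℚ) = 0 := by
      subst hi0 hj0
      funext r
      fin_cases r <;> simp
    rw [hz, hf0, zpow_zero, zpow_zero]
  · rw [← ksUnit_relation hc hs hcs hint]
    rfl

/-- The set of primes dividing `c`. -/
def primesOf (c : ℕ) : Set ℕ := {ℓ | ℓ.Prime ∧ ℓ ∣ c}

theorem exists_period {c : ℕ} (F : testFn₀ (primesOf c)) :
    ∃ t : ℕ, 0 < t ∧ c.Coprime t ∧ IsPeriod (toRat F) t ∧ IsDenom (toRat F) t := by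
  obtain ⟨t, ht, h1, h2⟩ := exists_level F
  refine ⟨t, ht, ?_, h2⟩
  refine Nat.coprime_of_dvd fun ℓ hℓ hc => h1 ℓ ⟨hℓ, hc⟩ hℓ

theorem odd_of_coprime_six {c : ℕ} (hc : c.Coprime 6) : Odd c :=
  Nat.Coprime.odd_of_right (hc.coprime_dvd_right (by decide))

/-- The Kato–Siegel distribution `μ_KS ∈ 𝒟'(V_{𝔸^S}, 𝒪_ℋ^×)`, `S` the set of primes dividing `c`:
the value at a test function which on `ℚ²` is `t ℤ²`-periodic, `t` prime to `c`, is
`∏_{v ∈ ℚ²/ℤ²} ϑ_c(v)^{f(t v)}`. So `μ_KS([v + ℤ²]) = ϑ_c(v)`, and `μ_KS` is invariant under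
scalars prime to `c`; the distribution relation for `ϑ_c` makes the value independent of `t`
and additive in `f`. -/
def katoSiegel (c : ℕ) (hc6 : c.Coprime 6) : Distribution (primesOf c) (Additive Holˣ) :=
  AddMonoidHom.mk' (fun F => Additive.ofMul (ksValue c (exists_period F).choose (toRat F))) (by
    intro F G
    have hc : Odd c := odd_of_coprime_six hc6
    rw [← ofMul_mul]
    congr 1
    obtain ⟨h0, hc0, hp0, hd0⟩ := (exists_period (F + G)).choose_spec
    obtain ⟨h1, hc1, hp1, hd1⟩ := (exists_period F).choose_spec
    obtain ⟨h2, hc2, hp2, hd2⟩ := (exists_period G).choose_spec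
    generalize (exists_period (F + G)).choose = t₀ at *
    generalize (exists_period F).choose = t₁ at *
    generalize (exists_period G).choose = t₂ at *
    rw [← ksValue_mul hc h0 (Nat.mul_pos h1 h2) h0 hc0 hc0 (hc1.mul_right hc2) (toRat_zero _) hp0 hd0,
      ← ksValue_mul hc h1 (Nat.mul_pos h0 h2) h1 hc1 hc1 (hc0.mul_right hc2) (toRat_zero _) hp1 hd1,
      ← ksValue_mul hc h2 (Nat.mul_pos h0 h1) h2 hc2 hc2 (hc0.mul_right hc1) (toRat_zero _) hp2 hd2,
      show t₁ * (t₀ * t₂) = t₀ * (t₁ * t₂) by ring, show t₂ * (t₀ * t₁) = t₀ * (t₁ * t₂) by ring]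
    have hT : 0 < t₀ * (t₁ * t₂) := Nat.mul_pos h0 (Nat.mul_pos h1 h2)
    have hden : ∀ {f : (Fin 2 → ℚ) → ℤ} {d : ℕ} (k : ℕ), IsDenom f d → IsDenom f (d * k) := by
      intro f d k hf v hv
      obtain ⟨w, hw⟩ := hf v hv
      refine ⟨fun i => w i * k, fun i => ?_⟩
      push_cast
      rw [← hw i]; ring
    have d0 := hden (t₁ * t₂) hd0
    have d1 := hden (t₀ * t₂) hd1
    have d2 := hden (t₀ * t₁) hd2
    rw [show t₁ * (t₀ * t₂) = t₀ * (t₁ * t₂) by ring] at d1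
    rw [show t₂ * (t₀ * t₁) = t₀ * (t₁ * t₂) by ring] at d2
    rw [ksValue_eq d0 rfl (Nat.mul_pos hT hT), ksValue_eq d1 rfl (Nat.mul_pos hT hT),
      ksValue_eq d2 rfl (Nat.mul_pos hT hT), toRat_add]
    simp_rw [← Finset.prod_mul_distrib]
    refine Finset.prod_congr rfl fun i _ => Finset.prod_congr rfl fun j _ => ?_
    rw [Pi.add_apply, _root_.zpow_add])

/-- The `δ`-smoothed Kato–Siegel distribution
`μ_KS^δ = δ ∗ (i_N^S)^* μ_KS ∈ 𝒟'(V_{𝔸^N}, 𝒪_ℋ^×)` with `δ = ∑_{D ∣ N} n_D [LR(D)]`, from the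
primes dividing `c` to the primes dividing `cN`. -/
def smoothedKatoSiegel (c N : ℕ) (hc : c.Coprime 6) (n : ℕ → ℤ) :
    Distribution (primesOf (c * N)) (Additive Holˣ) :=
  smooth (delta N n)
    (pullback (fun _ h => ⟨h.1, h.2.mul_right N⟩ : primesOf c ⊆ primesOf (c * N)) (katoSiegel c hc))

/-! ### The `q`-order -/

/-- `g` has a `q`-expansion at `i∞` with `Ord_q(g) = r`: for some `h > 0` it is a function of
`q_h = exp(2πiτ/h) = q^{1/h}` which is meromorphic at `q_h = 0`, of order `h r` there. -/
def HasQOrder (g : ℍ → ℂ) (r : ℚ) : Prop :=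
  ∃ (h : ℕ) (k : ℤ), 0 < h ∧ (∀ τ : ℍ, g ((h : ℝ) +ᵥ τ) = g τ) ∧
    MeromorphicAt (cuspFunction h g) 0 ∧ meromorphicOrderAt (cuspFunction h g) 0 = k ∧
    (k : ℚ) = h * r

end KatoSiegel

end

noncomputable section

namespace KatoSiegel

open UpperHalfPlane

/-! ### Leading exponents in fractional powers of `q` -/

/-! A function of the form q^r φ(q^{1/h}), with φ analytic and nonzero at 0, has leading exponent r.
Exponents add under products, are multiplied by n under n-th powers, and by D under τ ↦ Dτ. A
function of exponent 0 is φ(q^{1/h}) itself, so its q-order is 0. The theorem thus becomes a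
computation with exponents.

By the product expansion, the leading exponent of Θ(aτ + b, τ) depends on a alone
(`exists_hasLeadExp_Theta`), hence so does that of ϑ_c(aτ + b, τ); call the latter ρ(a). No closed
formula for ρ is needed. If f has period and denominator t, prime to c, then μ_KS(f) has exponent ∑
f(i/t, j/t) ρ(i/t²) over 0 ≤ i, j < t² (`hasLeadExp_ksValue`).

The action of LR(D) rescales only the second coordinate: (f ∣ LR(D))(x, Dy) = f(x, y). For t prime
to cN, multiplication by D permutes the residues j mod t², while ρ sees only i; so every f ∣ LR(D)
has the same sum E as f (`gridSum_testAct_LR`). The substitution τ ↦ Dτ turns E into D·E, and the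
smoothed unit has exponent (∑ n_D D)·E = 0. -/

/-- `g = q^r φ(q^{1/h})` for some `h > 0` and some `φ` analytic and nonvanishing at `0`. -/
def HasLeadExp (g : ℍ → ℂ) (r : ℚ) : Prop :=
  ∃ (h : ℕ) (φ : ℂ → ℂ), 0 < h ∧ AnalyticAt ℂ φ 0 ∧ φ 0 ≠ 0 ∧
    ∀ τ : ℍ, g τ = ee (r * τ) * φ (ee (τ / h))

namespace HasLeadExp

variable {f g : ℍ → ℂ} {r s : ℚ}

theorem const {a : ℂ} (ha : a ≠ 0) : HasLeadExp (fun _ => a) 0 :=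
  ⟨1, fun _ => a, one_pos, analyticAt_const, ha, fun τ => by simp [ee_zero]⟩

theorem ee_mul (r : ℚ) : HasLeadExp (fun τ => ee (r * τ)) r :=
  ⟨1, fun _ => 1, one_pos, analyticAt_const, one_ne_zero, fun τ => by simp⟩

theorem mul (hf : HasLeadExp f r) (hg : HasLeadExp g s) :
    HasLeadExp (fun τ => f τ * g τ) (r + s) := by
  obtain ⟨h, φ, hh, hφ, hφ0, e⟩ := hf
  obtain ⟨k, ψ, hk, hψ, hψ0, e'⟩ := hg
  have hhC : (h : ℂ) ≠ 0 := by exact_mod_cast hh.ne'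
  have hkC : (k : ℂ) ≠ 0 := by exact_mod_cast hk.ne'
  -- Common denominator: for z = e(τ/(hk)) the two old variables are e(τ/h) = z^k and e(τ/k) = z^h.
  refine ⟨h * k, fun z => φ (z ^ k) * ψ (z ^ h), Nat.mul_pos hh hk, ?_, ?_, fun τ => ?_⟩
  · refine AnalyticAt.mul (AnalyticAt.fun_comp ?_ ?_) (AnalyticAt.fun_comp ?_ ?_)
    · simpa [zero_pow hk.ne'] using hφ
    · fun_prop
    · simpa [zero_pow hh.ne'] using hψ
    · fun_prop
  · simpa [zero_pow hk.ne', zero_pow hh.ne'] using ⟨hφ0, hψ0⟩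
  · have e1 : (k : ℂ) * (τ / (h * k : ℕ)) = τ / h := by push_cast; field_simp
    have e2 : (h : ℂ) * (τ / (h * k : ℕ)) = τ / k := by push_cast; field_simp
    simp only
    rw [e, e', ← ee_nat_mul, ← ee_nat_mul, e1, e2, Rat.cast_add, add_mul, ee_add]
    ring

theorem inv (hf : HasLeadExp f r) : HasLeadExp (fun τ => (f τ)⁻¹) (-r) := by
  obtain ⟨h, φ, hh, hφ, hφ0, e⟩ := hf
  refine ⟨h, fun z => (φ z)⁻¹, hh, hφ.fun_inv hφ0, inv_ne_zero hφ0, fun τ => ?_⟩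
  simp only
  rw [e, mul_inv, Rat.cast_neg, neg_mul, ee_neg]

theorem pow (hf : HasLeadExp f r) (n : ℕ) : HasLeadExp (fun τ => f τ ^ n) (n * r) := by
  induction n with
  | zero => simpa using const one_ne_zero
  | succ n ih =>
    simp_rw [pow_succ]
    convert ih.mul hf using 1
    push_cast
    ring

theorem zpow (hf : HasLeadExp f r) (n : ℤ) : HasLeadExp (fun τ => f τ ^ n) (n * r) := by
  obtain ⟨k, rfl | rfl⟩ := n.eq_nat_or_neg
  · simpa using hf.pow k
  · simpa using (hf.pow k).inv

theorem prod {ι : Type*} (t : Finset ι) {F : ι → ℍ → ℂ} {R : ι → ℚ}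
    (hF : ∀ i ∈ t, HasLeadExp (F i) (R i)) :
    HasLeadExp (fun τ => ∏ i ∈ t, F i τ) (∑ i ∈ t, R i) := by
  classical
  induction t using Finset.induction_on with
  | empty => simpa using const one_ne_zero
  | insert a t ha ih =>
    simp_rw [Finset.prod_insert ha, Finset.sum_insert ha]
    exact (hF a (Finset.mem_insert_self a t)).mul
      (ih fun i hi => hF i (Finset.mem_insert_of_mem hi))

/-- The denominator h can be kept, because e(Dτ/h) is the D-th power of e(τ/h). The map `m` is left
abstract so that a Möbius action can be substituted for it. -/
theorem comp_natMul (hf : HasLeadExp f r) {D : ℕ} (hD : 0 < D) {m : ℍ → ℍ}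
    (hm : ∀ τ, (m τ : ℂ) = D * τ) : HasLeadExp (fun τ => f (m τ)) (D * r) := by
  obtain ⟨h, φ, hh, hφ, hφ0, e⟩ := hf
  refine ⟨h, fun z => φ (z ^ D), hh, ?_, ?_, fun τ => ?_⟩
  · refine AnalyticAt.fun_comp ?_ (by fun_prop)
    simpa [zero_pow hD.ne'] using hφ
  · simpa [zero_pow hD.ne'] using hφ0
  · simp only
    rw [e, hm, ← ee_nat_mul]
    push_cast
    congr 2
    · ring
    · rw [mul_div_assoc]

/-- With no factor q^r left, f is φ(q_h) and in particular h-periodic. Its cusp function agrees with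
φ on a punctured neighbourhood of 0, which is all that the meromorphic order sees. -/
theorem hasQOrder_zero (hf : HasLeadExp f 0) : HasQOrder f 0 := by
  obtain ⟨h, φ, hh, hφ, hφ0, e⟩ := hf
  have hhR : (0 : ℝ) < h := by exact_mod_cast hh
  have hhC : (h : ℂ) ≠ 0 := by exact_mod_cast hh.ne'
  have e' : ∀ τ : ℍ, f τ = φ (ee (τ / h)) := fun τ => by simpa [ee_zero] using e τ
  have hev : cuspFunction h f =ᶠ[nhdsWithin 0 {0}ᶜ] φ := by
    -- `cuspFunction` evaluates f through `ofComplex`, which is the identity only on the upper half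
    -- plane; a small z ≠ 0 has a logarithm `invQParam h z` of large imaginary part.
    have h1 : ∀ᶠ z in nhdsWithin (0 : ℂ) {0}ᶜ, 0 < (Function.Periodic.invQParam h z).im :=
      (Function.Periodic.invQParam_tendsto hhR).eventually
        (tendsto_comap.eventually (eventually_gt_atTop 0))
    filter_upwards [h1, self_mem_nhdsWithin] with z hz hz0
    rw [UpperHalfPlane.cuspFunction, Function.Periodic.cuspFunction_eq_of_nonzero _ _ hz0,
      Function.comp_apply, e', ofComplex_apply_of_im_pos hz]
    congr 1
    have := Function.Periodic.qParam_right_inv hhR.ne' hz0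
    rw [Function.Periodic.qParam] at this
    refine Eq.trans ?_ this
    rw [ee]
    congr 1
    simp only [Complex.ofReal_natCast]
    ring
  have hmer : MeromorphicAt φ 0 := hφ.meromorphicAt
  refine ⟨h, 0, hh, fun τ => ?_, hmer.congr hev.symm, ?_, by simp⟩
  · rw [e', e', coe_vadd]
    congr 1
    push_cast
    rw [add_div, div_self hhC, ee_add, show ee 1 = 1 by simpa using ee_int 1, one_mul]
  · rw [meromorphicOrderAt_congr hev, hφ.meromorphicOrderAt_eq, (hφ.analyticOrderAt_eq_zero).2 hφ0]
    rfl

end HasLeadExp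

/-! ### Expansions of Θ and ϑ_c at the cusp -/

/-- On the disc |z| < 1/2 the n-th factor differs from 1 by at most 2^{-n} |ζ|, because hn + p ≥ n.
The product therefore converges locally uniformly there. -/
theorem analyticAt_tprod_one_sub {h p : ℕ} (hh : 0 < h) (hp : 0 < p) (ζ : ℂ) :
    AnalyticAt ℂ (fun z => ∏' n : ℕ, (1 - z ^ (h * n + p) * ζ)) 0 := by
  have hm : HasProdLocallyUniformlyOn (fun (n : ℕ) z => 1 - z ^ (h * n + p) * ζ)
      (fun z => ∏' n : ℕ, (1 - z ^ (h * n + p) * ζ)) (Metric.ball 0 (1 / 2)) := by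
    simp_rw [sub_eq_add_neg]
    apply hasProdLocallyUniformlyOn_of_forall_compact Metric.isOpen_ball
    intro K hK hcK
    refine ((summable_geometric_of_lt_one (r := (1 / 2 : ℝ)) (by norm_num)
      (by norm_num)).mul_right ‖ζ‖).hasProdUniformlyOn_nat_one_add hcK
      (.of_forall fun n x hx => ?_) (fun n => by fun_prop)
    have hx' : ‖x‖ ≤ 1 / 2 := (mem_ball_zero_iff.1 (hK hx)).le
    rw [norm_neg, norm_mul, norm_pow]
    gcongr
    calc ‖x‖ ^ (h * n + p) ≤ ‖x‖ ^ n := by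
          refine pow_le_pow_of_le_one (norm_nonneg _) (hx'.trans (by norm_num)) ?_
          nlinarith
      _ ≤ _ := pow_le_pow_left₀ (norm_nonneg _) hx' n
  have hd := hm.differentiableOn (.of_forall fun s => by fun_prop) Metric.isOpen_ball
  exact hd.analyticAt (Metric.isOpen_ball.mem_nhds (by simp))

/-- Write a = p/h and z = e(τ/h). Then e(aτ + b) = z^p e(b), and each factor is a polynomial in z.
As 0 ≤ p < h, every exponent of z is positive, except that of z^p when p = 0. The value at z = 0 is
thus 1, or 1 - e(b) if a = 0, and in the latter case b is not an integer. -/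
theorem hasLeadExp_thF {a : ℚ} (ha0 : 0 ≤ a) (ha1 : a < 1) {b : ℚ}
    (hab : ¬ ∃ m n : ℤ, a = m ∧ b = n) :
    HasLeadExp (fun τ => thF (ee τ) (ee (a * τ + b))) 0 := by
  have hden : (0 : ℚ) < a.den := by exact_mod_cast a.den_pos
  obtain ⟨h, p, hh, hph, rfl⟩ : ∃ h p : ℕ, 0 < h ∧ p < h ∧ a = p / h := by
    refine ⟨a.den, a.num.toNat, a.den_pos, ?_, ?_⟩
    · have : a.num < a.den := by
        have := Rat.num_div_den a
        rw [← this, div_lt_one hden] at ha1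
        exact_mod_cast ha1
      have := Rat.num_nonneg.2 ha0
      omega
    · have h2 : ((a.num.toNat : ℤ) : ℚ) = a.num := by rw [Int.toNat_of_nonneg (Rat.num_nonneg.2 ha0)]
      rw [Int.cast_natCast] at h2
      rw [h2, Rat.num_div_den]
  have hhC : (h : ℂ) ≠ 0 := by exact_mod_cast hh.ne'
  -- The exponents are h(n + 1) ± p, from q^{n+1} e(aτ + b)^{±1}; the natural subtraction h - p does
  -- not truncate because p < h.
  refine ⟨h, fun z => (1 - z ^ p * ee b) * (∏' n : ℕ, (1 - z ^ (h * n + (h + p)) * ee b)) *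
    ∏' n : ℕ, (1 - z ^ (h * n + (h - p)) * (ee b)⁻¹), hh, ?_, ?_, fun τ => ?_⟩
  · exact ((by fun_prop : AnalyticAt ℂ (fun z => 1 - z ^ p * ee b) 0).mul
      (analyticAt_tprod_one_sub hh (by omega) _)).mul (analyticAt_tprod_one_sub hh (by omega) _)
  · have h1 : ∀ n, (0 : ℂ) ^ (h * n + (h + p)) = 0 := fun n => zero_pow (by omega)
    have h2 : ∀ n, (0 : ℂ) ^ (h * n + (h - p)) = 0 := fun n => zero_pow (by omega)
    simp only [h1, h2, zero_mul, sub_zero, tprod_one, mul_one]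
    rcases Nat.eq_zero_or_pos p with rfl | hp
    · rw [pow_zero, one_mul, sub_ne_zero]
      intro h3
      obtain ⟨n, hn⟩ := (ee_eq_one_iff _).1 h3.symm
      exact hab ⟨0, n, by simp, by exact_mod_cast hn⟩
    · simp [zero_pow hp.ne']
  · have e1 : ee τ = ee (τ / h) ^ h := by rw [← ee_nat_mul]; congr 1; field_simp
    have e2 : ee (((p / h : ℚ) : ℂ) * τ + b) = ee (τ / h) ^ p * ee b := by
      rw [← ee_nat_mul, ← ee_add]; congr 1; push_cast; field_simp
    simp only [thF, eul]
    rw [Rat.cast_zero, zero_mul, ee_zero, one_mul, e2, e1]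
    have hz := ee_ne_zero ((τ : ℂ) / h)
    generalize ee ((τ : ℂ) / h) = z at hz
    refine congrArg₂ _ (congrArg₂ _ rfl (tprod_congr fun n => ?_)) (tprod_congr fun n => ?_)
    · ring
    · congr 1
      have : z ^ (h * n + (h - p)) * z ^ p = (z ^ h) ^ (n + 1) := by
        rw [← pow_add, ← pow_mul]; congr 1; rw [Nat.mul_succ]; omega
      rw [← this, mul_inv]
      field_simp

/-- Quasi-periodicity, inherited from `thF_mul`. For u = aτ + b it raises a by 1 at the cost of a
factor with exponent -1/2 - a, in which b appears only through a constant. -/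
theorem Theta_add_self (τ : ℍ) (u : ℂ) :
    Theta (u + τ) τ = ee (1 / 2 - τ / 2 - u) * Theta u τ := by
  rw [Theta_eq_thF τ.im_pos, Theta_eq_thF τ.im_pos, ee_add u, mul_comm (ee u),
    thF_mul (norm_ee_lt_one τ.im_pos) (ee_ne_zero _) (ee_ne_zero _), neg_eq_neg_one_mul,
    ← ee_half, ← ee_neg]
  simp only [← mul_assoc, ← ee_add]
  congr 2
  ring

/-- The leading exponent of `Θ(aτ + b, τ)` depends only on `a`. -/
theorem exists_hasLeadExp_Theta {a : ℚ} (ha : 0 ≤ a) : ∃ r : ℚ, ∀ b : ℚ,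
    (¬ ∃ m n : ℤ, a = m ∧ b = n) → HasLeadExp (fun τ => Theta (a * τ + b) τ) r := by
  -- Fractional part plus integer part: `hasLeadExp_thF` requires 0 ≤ a < 1, but Θ(cu, τ) leads to
  -- exponents beyond that range. Quantifying r before b records the independence of b.
  suffices H : ∀ (k : ℕ) (a : ℚ), 0 ≤ a → a < 1 → ∃ r : ℚ, ∀ b : ℚ,
      (¬ ∃ m n : ℤ, a = m ∧ b = n) → HasLeadExp (fun τ => Theta ((a + k : ℚ) * τ + b) τ) r by
    obtain ⟨r, hr⟩ := H ⌊a⌋₊ (a - ⌊a⌋₊) (sub_nonneg.2 (Nat.floor_le ha))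
      (by linarith [Nat.lt_floor_add_one a])
    refine ⟨r, fun b hb => ?_⟩
    have := hr b (by
      rintro ⟨m, n, hm, hn⟩
      exact hb ⟨m + ⌊a⌋₊, n, by push_cast; linarith, hn⟩)
    simpa using this
  intro k a ha0 ha1
  induction k with
  | zero =>
    -- The prefactor e(τ/12 + 1/2 - u/2) with u = aτ + b contributes 1/12 - a/2; the zeros belong to
    -- its constant part and to `thF`.
    refine ⟨(1 / 12 - a / 2) + 0 + 0, fun b hb => ?_⟩
    convert ((HasLeadExp.ee_mul (1 / 12 - a / 2)).mul
      (HasLeadExp.const (ee_ne_zero (1 / 2 - b / 2)))).mul (hasLeadExp_thF ha0 ha1 hb) using 2 with τ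
    rw [Nat.cast_zero, add_zero, Theta_eq_thF τ.im_pos, ← ee_add]
    congr 2
    push_cast
    ring
  | succ k ih =>
    obtain ⟨r, hr⟩ := ih
    -- The factor of `Theta_add_self` at u = (a + k)τ + b.
    refine ⟨(-(1 / 2) - (a + k)) + 0 + r, fun b hb => ?_⟩
    convert ((HasLeadExp.ee_mul (-(1 / 2) - (a + k))).mul
      (HasLeadExp.const (ee_ne_zero (1 / 2 - b)))).mul (hr b hb) using 2 with τ
    have : ((a + (k + 1 : ℕ) : ℚ) : ℂ) * τ + b = ((a + k : ℚ) * τ + b) + τ := by push_cast; ring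
    rw [this, Theta_add_self, ← ee_add]
    congr 2
    push_cast
    ring

theorem unitFun_ksUnit {c : ℕ} {v : Fin 2 → ℚ} (hv : ¬ IsIntegral fun i => c * v i) :
    unitFun (Additive.ofMul (ksUnit c v)) = ksFun c v := by
  rw [ksUnit, dif_neg hv]
  rfl

/-- The leading exponent of `ϑ_c(aτ + b, τ)` depends only on `a`. -/
theorem exists_hasLeadExp_ksUnit (c : ℕ) {a : ℚ} (ha : 0 ≤ a) : ∃ r : ℚ, ∀ b : ℚ,
    (¬ IsIntegral fun i => c * (![a, b] : Fin 2 → ℚ) i) →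
      HasLeadExp (unitFun (Additive.ofMul (ksUnit c ![a, b]))) r := by
  obtain ⟨r, hr⟩ := exists_hasLeadExp_Theta ha
  obtain ⟨s, hs⟩ := exists_hasLeadExp_Theta (mul_nonneg c.cast_nonneg ha : 0 ≤ (c : ℚ) * a)
  -- The three terms come from the sign, from Θ(u, τ)^{c²} and from Θ(cu, τ)⁻¹.
  refine ⟨0 + ((c ^ 2 : ℕ) : ℚ) * r + -s, fun b hb => ?_⟩
  rw [unitFun_ksUnit hb]
  have h1 := hr b (by
    rintro ⟨m, n, rfl, rfl⟩
    exact hb ⟨c * m, c * n, by simp, by simp⟩)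
  have h2 := hs (c * b) (by
    rintro ⟨m, n, hm, hn⟩
    exact hb ⟨m, n, by simpa using hm, by simpa using hn⟩)
  convert ((HasLeadExp.const (a := (-1) ^ ((c - 1) / 2)) (by simp)).mul
    (h1.pow (c ^ 2))).mul h2.inv using 2 with τ
  simp only [ksFun, Matrix.cons_val_zero, Matrix.cons_val_one]
  congr 3
  push_cast
  ring

/-! ### The exponent of the Kato–Siegel distribution -/

/-- Evaluation of units at a point of `ℋ`. -/
def evalUnit (τ : ℍ) : Holˣ →* ℂ :=
  ((Pi.evalRingHom (fun _ : ℍ => ℂ) τ).comp Hol.subtype : Hol →* ℂ).comp (Units.coeHom Hol)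

theorem unitFun_apply (u : Additive Holˣ) (τ : ℍ) : unitFun u τ = evalUnit τ u.toMul := rfl

theorem unitFun_sum {ι : Type*} (s : Finset ι) (u : ι → Additive Holˣ) :
    unitFun (∑ i ∈ s, u i) = fun τ => ∏ i ∈ s, unitFun (u i) τ := by
  funext τ
  simp only [unitFun_apply, toMul_sum, map_prod]

theorem unitFun_zsmul (n : ℤ) (u : Additive Holˣ) :
    unitFun (n • u) = fun τ => unitFun u τ ^ n := by
  funext τ
  -- The multiplicative monoid ℂ is not a group, so compatibility of evaluation with inverses is
  -- proved directly.
  simp only [unitFun_apply, toMul_zsmul, map_zpow' (evalUnit τ) (fun u => by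
    rw [eq_comm, inv_eq_iff_eq_inv, eq_comm]
    refine inv_eq_of_mul_eq_one_left ?_
    rw [← map_mul, mul_inv_cancel, map_one])]

/-- Removes the choice in the definition: by `ksValue_mul`, the chosen period and t both give the
value computed with their product. -/
theorem katoSiegel_apply {c t : ℕ} (hc6 : c.Coprime 6) (F : testFn₀ (primesOf c)) (ht : 0 < t)
    (hct : c.Coprime t) (hper : IsPeriod (toRat F) t) (hden : IsDenom (toRat F) t) :
    katoSiegel c hc6 F = Additive.ofMul (ksValue c t (toRat F)) := by
  have hc := odd_of_coprime_six hc6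
  obtain ⟨h1, hc1, hp1, hd1⟩ := (exists_period F).choose_spec
  change Additive.ofMul (ksValue c (exists_period F).choose (toRat F)) = _
  rw [← ksValue_mul hc h1 ht h1 hc1 hc1 hct (toRat_zero _) hp1 hd1, mul_comm,
    ksValue_mul hc ht h1 ht hct hct hc1 (toRat_zero _) hper hden]

/-- The sum of `f(i/t, j/t) ρ(i/t²)` over `0 ≤ i, j < t²`. -/
def gridSum (ρ : ℚ → ℚ) (t : ℕ) (f : (Fin 2 → ℚ) → ℤ) : ℚ :=
  ∑ i ∈ Finset.range (t * t), ∑ j ∈ Finset.range (t * t),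
    f ![(i : ℚ) / t, (j : ℚ) / t] * ρ ((i : ℚ) / (t * t : ℕ))

/-- With t as both period and denominator, only the points (i/t², j/t²) contribute, and f is
evaluated there at t times the point, that is at (i/t, j/t). -/
theorem hasLeadExp_ksValue {c t : ℕ} {f : (Fin 2 → ℚ) → ℤ} {ρ : ℚ → ℚ}
    (hρ : ∀ a, 0 ≤ a → ∀ b : ℚ, (¬ IsIntegral fun i => c * (![a, b] : Fin 2 → ℚ) i) →
      HasLeadExp (unitFun (Additive.ofMul (ksUnit c ![a, b]))) (ρ a))
    (ht : 0 < t) (hct : c.Coprime t) (hf0 : f 0 = 0) (hden : IsDenom f t) :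
    HasLeadExp (unitFun (Additive.ofMul (ksValue c t f))) (gridSum ρ t f) := by
  have hm0 : 0 < t * t := Nat.mul_pos ht ht
  have htQ : (t : ℚ) ≠ 0 := by exact_mod_cast ht.ne'
  have hmQ : (0 : ℚ) < (t * t : ℕ) := by exact_mod_cast hm0
  have hcm : c.Coprime (t * t) := hct.mul_right hct
  rw [ksValue_eq hden rfl hm0, ofMul_prod, unitFun_sum]
  refine HasLeadExp.prod _ fun i hi => ?_
  rw [ofMul_prod, unitFun_sum]
  refine HasLeadExp.prod _ fun j hj => ?_
  have e : ∀ k : ℕ, (t : ℚ) * ((k : ℚ) / (t * t : ℕ)) = k / t := by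
    intro k; push_cast; field_simp
  rw [ofMul_zpow, unitFun_zsmul, e, e]
  by_cases hint : IsIntegral fun r =>
      c * (![(i : ℚ) / (t * t : ℕ), (j : ℚ) / (t * t : ℕ)] : Fin 2 → ℚ) r
  -- Points v with cv integral have no expansion of ϑ_c. Since c is prime to t², the origin is the
  -- only one, and f(0) = 0 makes its contribution trivial.
  · have key : ∀ a : ℕ, a < t * t → (∃ n : ℤ, c * ((a : ℚ) / (t * t : ℕ)) = n) → a = 0 := by
      rintro a ha ⟨n, hn⟩
      have h1 : (c : ℚ) * a = n * (t * t : ℕ) := by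
        rw [← hn]; field_simp
      have h2 : (c : ℤ) * a = n * (t * t : ℕ) := by exact_mod_cast h1
      have h3 : ((t * t : ℕ) : ℤ) ∣ c * a := ⟨n, by rw [h2]; ring⟩
      have h4 : t * t ∣ a := hcm.symm.dvd_of_dvd_mul_left (by exact_mod_cast h3)
      exact Nat.eq_zero_of_dvd_of_lt h4 ha
    obtain ⟨n, n', hn, hn'⟩ := hint
    have hi0 := key i (Finset.mem_range.1 hi) ⟨n, hn⟩
    have hj0 := key j (Finset.mem_range.1 hj) ⟨n', hn'⟩
    have hz : (![(i : ℚ) / t, (j : ℚ) / t] : Fin 2 → ℚ) = 0 := by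
      subst hi0 hj0
      funext r
      fin_cases r <;> simp
    simpa [hz, hf0] using HasLeadExp.const one_ne_zero
  · exact (hρ _ (by positivity) _ hint).zpow _

/-! ### Test functions under extension and under `LR(D)` -/

/-- Integrality at S followed by integrality at T - S is integrality at T, so both functions come
from the same restriction to ℚ². -/
theorem toRat_extend {S T : Set ℕ} (h : S ⊆ T) (F : testFn₀ T) :
    toRat (extend h F) = toRat F := by
  classical
  funext v
  rw [toRat_apply, toRat_apply]
  change (if _ then (if _ then F.1 (fun i => diag T (v i)) else 0) else 0) = _
  by_cases hT : ∀ ℓ : Off ∅, (ℓ : ℕ) ∈ T → ∀ i, ‖((v i : ℚ) : ℚ_[(ℓ : ℕ)])‖ ≤ 1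
  · rw [if_pos hT, if_pos fun ℓ hℓ => hT ℓ (h hℓ)]
    exact if_pos fun (ℓ : Off S) hℓ i => hT ⟨ℓ, ℓ.2.1, Set.notMem_empty _⟩ hℓ i
  · rw [if_neg hT]
    split_ifs with h1 h2
    · refine absurd (fun ℓ hℓ i => ?_) hT
      by_cases hS : (ℓ : ℕ) ∈ S
      · exact h1 ℓ hS i
      · exact h2 ⟨ℓ, ℓ.2.1, hS⟩ hℓ i
    · rfl
    · rfl

/-- At such vectors the added factors f_ℓ^0, ℓ ∈ S, all take the value 1. -/
theorem toRat_of_integral {S : Set ℕ} (F : testFn₀ S) {v : Fin 2 → ℚ}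
    (hv : ∀ ℓ ∈ S, ℓ.Prime → ∀ i, ¬ ℓ ∣ (v i).den) : toRat F v = F.1 fun i => diag S (v i) := by
  classical
  rw [toRat_apply, if_pos]
  exact fun ℓ hℓ i => Padic.norm_rat_le_one (hv ℓ hℓ ℓ.2.1 i)

theorem vecAct_LR_diag {S : Set ℕ} {D : ℚ} (hD : 0 < D) (x y : ℚ) :
    vecAct (S := S) (LR D hD : GL (Fin 2) ℚ) (fun i => diag S (![x, D * y] i)) =
      fun i => diag S (![x, y] i) := by
  have hinv : (((LR D hD : GL (Fin 2) ℚ)⁻¹ : GL (Fin 2) ℚ) : Matrix (Fin 2) (Fin 2) ℚ) =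
      !![1, 0; 0, D⁻¹] := by
    rw [Matrix.coe_units_inv]
    refine Matrix.inv_eq_right_inv ?_
    change !![1, 0; 0, D] * _ = _
    simp [hD.ne', Matrix.one_fin_two]
  funext i
  rw [vecAct, hinv]
  simp only [vecMul, dotProduct, Fin.sum_univ_two, Matrix.map_apply, ← map_mul, ← map_add]
  congr 1
  fin_cases i
  · simp
  · simp [mul_comm D y, hD.ne']

/-- The action takes place before tensoring with the f_ℓ^0, ℓ ∈ S, and leaves these factors alone
although D may be divisible by primes of S. The identity on ℚ² is therefore stated at vectors that
are integral at S on both sides. -/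
theorem toRat_testAct_LR {S : Set ℕ} (F : testFn₀ S) {D : ℚ} (hD : 0 < D) {x y : ℚ}
    (hx : ∀ ℓ ∈ S, ℓ.Prime → ¬ ℓ ∣ x.den) (hy : ∀ ℓ ∈ S, ℓ.Prime → ¬ ℓ ∣ y.den)
    (hDy : ∀ ℓ ∈ S, ℓ.Prime → ¬ ℓ ∣ (D * y).den) :
    toRat (testAct (LR D hD : GL (Fin 2) ℚ) F) ![x, D * y] = toRat F ![x, y] := by
  rw [toRat_of_integral, toRat_of_integral]
  · exact congrArg F.1 (vecAct_LR_diag hD x y)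
  · intro ℓ hS hℓ i
    fin_cases i
    exacts [hx ℓ hS hℓ, hy ℓ hS hℓ]
  · intro ℓ hS hℓ i
    fin_cases i
    exacts [hx ℓ hS hℓ, hDy ℓ hS hℓ]

/-! ### Invariance of the grid sum under LR(D); common levels -/

/-- Multiplication by the unit D permutes the residues mod m. -/
theorem sum_range_mul_of_periodic {M : Type*} [AddCommMonoid M] {D m : ℕ} (hm : 0 < m)
    (hD : D.Coprime m) {H : ℕ → M} (hH : Function.Periodic H m) :
    ∑ i ∈ Finset.range m, H (D * i) = ∑ i ∈ Finset.range m, H i := by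
  have hmaps : ∀ i ∈ Finset.range m, D * i % m ∈ Finset.range m := fun i _ =>
    Finset.mem_range.2 (Nat.mod_lt _ hm)
  have hinj : Set.InjOn (fun i => D * i % m) (Finset.range m : Set ℕ) := by
    intro i hi j hj hij
    have : i ≡ j [MOD m] := Nat.ModEq.cancel_left_of_coprime hD.symm hij
    rwa [Nat.ModEq, Nat.mod_eq_of_lt (Finset.mem_range.1 hi),
      Nat.mod_eq_of_lt (Finset.mem_range.1 hj)] at this
  exact Finset.sum_nbij (fun i => D * i % m) hmaps hinj
    (Finset.surjOn_of_injOn_of_card_le _ hmaps hinj le_rfl) fun i _ => (hH.map_mod_nat _).symm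

/-- The weight ρ depends on the first coordinate only and LR(D) moves the second only. For fixed i
the inner sum is thus reindexed by j ↦ Dj mod t². -/
theorem gridSum_testAct_LR {S : Set ℕ} (F : testFn₀ S) (ρ : ℚ → ℚ) {t D : ℕ} (ht : 0 < t)
    (htS : ∀ ℓ ∈ S, ℓ.Prime → ¬ ℓ ∣ t) (hD : (0 : ℚ) < D) (hDt : D.Coprime t)
    (hper : IsPeriod (toRat (testAct (LR D hD : GL (Fin 2) ℚ) F)) t) :
    gridSum ρ t (toRat (testAct (LR D hD : GL (Fin 2) ℚ) F)) = gridSum ρ t (toRat F) := by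
  have htQ : (t : ℚ) ≠ 0 := by exact_mod_cast ht.ne'
  -- Grid coordinates have denominators dividing t, so they are integral at the primes of S, as
  -- `toRat_testAct_LR` demands.
  have hint : ∀ k : ℕ, ∀ ℓ ∈ S, ℓ.Prime → ¬ ℓ ∣ ((k : ℚ) / t).den := by
    intro k ℓ hS hℓ h
    refine htS ℓ hS hℓ (h.trans ?_)
    have := Rat.den_dvd (k : ℤ) (t : ℤ)
    exact_mod_cast this
  refine Finset.sum_congr rfl fun i _ => ?_
  rw [← sum_range_mul_of_periodic (Nat.mul_pos ht ht) (hDt.mul_right hDt)]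
  · refine Finset.sum_congr rfl fun j _ => ?_
    congr 2
    have e : ((D * j : ℕ) : ℚ) / t = D * ((j : ℚ) / t) := by push_cast; ring
    rw [e]
    exact toRat_testAct_LR F hD (hint i) (hint j) (e ▸ hint (D * j))
  · intro j
    refine congrArg (fun k : ℤ => (k : ℚ) * ρ ((i : ℚ) / (t * t : ℕ))) ?_
    -- Raising j by t² moves j/t by t, exactly one period.
    rw [← hper ![(i : ℚ) / t, (j : ℚ) / t] ![0, 1]]
    congr 1
    funext r
    fin_cases r
    · simp
    · simp only [Fin.mk_one, Matrix.cons_val_one]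
      push_cast
      field_simp

theorem IsPeriod.mul {f : (Fin 2 → ℚ) → ℤ} {t : ℕ} (h : IsPeriod f t) (k : ℕ) :
    IsPeriod f (t * k) := by
  intro v w
  rw [← h v fun i => k * w i]
  congr 1
  funext i
  push_cast
  ring

theorem IsDenom.mul {f : (Fin 2 → ℚ) → ℤ} {d : ℕ} (h : IsDenom f d) (k : ℕ) :
    IsDenom f (d * k) := by
  intro v hv
  obtain ⟨w, hw⟩ := h v hv
  refine ⟨fun i => w i * k, fun i => ?_⟩
  push_cast
  rw [← hw i]
  ring

/-- A multiple of a level is a level, so the product of the individual levels serves. -/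
theorem exists_common_level {ι : Type*} {S : Set ℕ} (s : Finset ι) (G : ι → testFn₀ S) :
    ∃ t : ℕ, 0 < t ∧ (∀ ℓ ∈ S, ℓ.Prime → ¬ ℓ ∣ t) ∧
      ∀ i ∈ s, IsPeriod (toRat (G i)) t ∧ IsDenom (toRat (G i)) t := by
  classical
  choose m hm hmS hper hden using fun i => exists_level (G i)
  refine ⟨∏ i ∈ s, m i, Finset.prod_pos fun i _ => hm i, fun ℓ hS hℓ hdvd => ?_, fun i hi => ?_⟩
  · obtain ⟨i, _, hi⟩ := (Prime.dvd_finsetProd_iff hℓ.prime _).1 hdvd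
    exact hmS i ℓ hS hℓ hi
  · rw [← Finset.mul_prod_erase _ _ hi]
    exact ⟨(hper i).mul _, (hden i).mul _⟩

/-! ### The smoothed distribution -/

/-- LR(D) acts as τ ↦ τ/D. The inverse occurring in `distAct` is what produces the substitution τ ↦
Dτ. -/
theorem coe_moebius_LR_inv {D : ℚ} (hD : 0 < D) (τ : ℍ) :
    (moebius (LR D hD)⁻¹ τ : ℂ) = D * τ := by
  have hDC : (D : ℂ) ≠ 0 := by exact_mod_cast hD.ne'
  set g := Matrix.GeneralLinearGroup.map (algebraMap ℚ ℝ) (LR D hD : GL (Fin 2) ℚ) with hg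
  have hm : moebius (LR D hD)⁻¹ τ = g⁻¹ • τ := by
    rw [moebius, hg, ← map_inv]
    rfl
  -- Instead of inverting the matrix, g is evaluated at w = g⁻¹τ and the result w/D = τ is solved
  -- for w.
  have h1 : g • moebius (LR D hD)⁻¹ τ = τ := by rw [hm, smul_inv_smul]
  generalize moebius (LR D hD)⁻¹ τ = w at h1
  have hmat : (g : Matrix (Fin 2) (Fin 2) ℝ) = !![1, 0; 0, (D : ℝ)] := by
    ext i j
    fin_cases i <;> fin_cases j <;>
      simp [hg, LR, Matrix.GeneralLinearGroup.mkOfDetNeZero]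
  have hdet : 0 < g.det.val := by
    rw [Matrix.GeneralLinearGroup.val_det_apply, hmat, Matrix.det_fin_two_of]
    have : (0 : ℝ) < D := by exact_mod_cast hD
    simpa
  rw [← h1, coe_smul_of_det_pos hdet, num, denom, hmat]
  simp
  field_simp

/-- The sum over the support of δ is additive in δ, so it can be taken one divisor at a time,
without comparing the matrices LR(D). Attaching membership supplies D > 0. -/
theorem smooth_delta {S : Set ℕ} (N : ℕ) (n : ℕ → ℤ) (μ : Distribution S (Additive Holˣ))
    (F : testFn₀ S) : smooth (delta N n) μ F = ∑ D ∈ N.divisors.attach,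
      n D • distAct (LR (D : ℕ) (by exact_mod_cast Nat.pos_of_mem_divisors D.2)) μ F := by
  classical
  rw [smooth, delta, MonoidAlgebra.coeff_sum, ← Finsupp.sum_finsetSum_index
    (h := fun (g : GL(2, ℚ)⁺) (k : ℤ) => k • distAct g μ) (fun _ => zero_smul _ _)
    (fun _ _ _ => add_smul _ _ _)]
  simp only [MonoidAlgebra.coeff_single, Finsupp.sum_single_index, zero_smul]
  rw [AddMonoidHom.finsetSum_apply]
  rfl

/-- This is where the weight D of the hypothesis ∑ n_D D = 0 arises. -/
theorem unitFun_distAct_LR {S : Set ℕ} {D : ℕ} (hD : (0 : ℚ) < D)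
    (μ : Distribution S (Additive Holˣ)) (F : testFn₀ S) {r : ℚ}
    (h : HasLeadExp (unitFun (μ (testAct (LR D hD : GL (Fin 2) ℚ) F))) r) :
    HasLeadExp (unitFun (distAct (LR D hD) μ F)) (D * r) :=
  h.comp_natMul (m := moebius (LR D hD)⁻¹) (by exact_mod_cast hD) fun τ => by
    simpa using coe_moebius_LR_inv hD τ

theorem primesOf_subset (c N : ℕ) : primesOf c ⊆ primesOf (c * N) :=
  fun _ h => ⟨h.1, h.2.mul_right N⟩

end KatoSiegel

end

/-! ### Conclusion: the total exponent vanishes -/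

open KatoSiegel in
theorem mainTheorem8 (c N : ℕ) (hc : 1 < c) (hc6 : c.Coprime 6) (hN : 1 < N)
    (hcN : N.Coprime c) (n : ℕ → ℤ) (hn : ∑ D ∈ N.divisors, n D * (D : ℤ) = 0)
    (f : KatoSiegel.testFn₀ (KatoSiegel.primesOf (c * N))) :
    KatoSiegel.HasQOrder
      (KatoSiegel.unitFun (KatoSiegel.smoothedKatoSiegel c N hc6 n f)) 0 := by
  have hpos : ∀ D : N.divisors, (0 : ℚ) < (D : ℕ) := fun D => by
    exact_mod_cast Nat.pos_of_mem_divisors D.2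
  have hρ' : ∀ a : ℚ, ∃ r : ℚ, 0 ≤ a → ∀ b : ℚ,
      (¬ IsIntegral fun i => c * (![a, b] : Fin 2 → ℚ) i) →
        HasLeadExp (unitFun (Additive.ofMul (ksUnit c ![a, b]))) r := by
    intro a
    by_cases ha : 0 ≤ a
    · exact (exists_hasLeadExp_ksUnit c ha).imp fun r hr _ => hr
    · exact ⟨0, fun h => absurd h ha⟩
  choose ρ hρ using hρ'
  -- One level t for all translates f ∣ LR(D) puts all exponents on the same grid. It is prime to
  -- cN, hence to c and to every D dividing N.
  obtain ⟨t, ht, htS, hlev⟩ := exists_common_level N.divisors.attach fun D =>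
    testAct (LR (D : ℕ) (hpos D) : Matrix.GeneralLinearGroup (Fin 2) ℚ) f
  have hcop : (c * N).Coprime t :=
    Nat.coprime_of_dvd fun ℓ hℓ hd => htS ℓ ⟨hℓ, hd⟩ hℓ
  have hct : c.Coprime t := hcop.coprime_mul_right
  have hNt : N.Coprime t := hcop.coprime_mul_left
  refine HasLeadExp.hasQOrder_zero ?_
  have hsm : smoothedKatoSiegel c N hc6 n f = _ :=
    smooth_delta N n (pullback (primesOf_subset c N) (katoSiegel c hc6)) f
  rw [hsm, unitFun_sum]
  -- The grid sum of f does not depend on D and factors out, leaving ∑ n_D D = 0.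
  have hsum : (0 : ℚ) = ∑ D ∈ N.divisors.attach,
      n D * (((D : ℕ) : ℚ) * gridSum ρ t (toRat f)) := by
    rw [Finset.sum_attach N.divisors fun D => (n D : ℚ) * ((D : ℚ) * gridSum ρ t (toRat f))]
    simp_rw [← mul_assoc]
    rw [← Finset.sum_mul]
    have : (∑ D ∈ N.divisors, (n D : ℚ) * (D : ℚ)) = 0 := by exact_mod_cast hn
    rw [this, zero_mul]
  refine Eq.mpr (congrArg _ hsum) ?_
  refine HasLeadExp.prod _ fun D hD => ?_
  rw [unitFun_zsmul]
  refine HasLeadExp.zpow (unitFun_distAct_LR (hpos D) _ f ?_) _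
  obtain ⟨hper, hden⟩ := hlev D hD
  -- The common value is traded for the grid sum of f ∣ LR(D), which is the one attached to the D-th
  -- factor.
  rw [← gridSum_testAct_LR f ρ ht htS (hpos D)
    (hNt.coprime_dvd_left (Nat.dvd_of_mem_divisors D.2)) hper]
  -- The Kato–Siegel distribution takes test functions away from the primes of c, so level and grid
  -- sum are transported to the extension f^D.
  rw [← toRat_extend (primesOf_subset c N)]
    at hper hden ⊢
  rw [pullback, AddMonoidHom.comp_apply, katoSiegel_apply hc6 _ ht hct hper hden]
  exact hasLeadExp_ksValue hρ ht hct (toRat_zero _) hden
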